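/- A \emph{local measure} is a function $\mu\colon\{B\subseteq\mathbb{R}: B \text{ bounded Borel}\}\to\mathbb{C}$ such that $\mathbf 1_K\mu:=\mu(\cdot\cap K)$ is a complex Radon measure for every compact $K\subseteq\mathbb{R}$; $|\mu|$ denotes its total variation and $\|\mu\|_{\mathrm{unif}}:=\sup_{x\in\mathbb{R}}|\mu|((x,x+1])$. For $p\in\mathbb{R}$ let $\mu(\cdot+p)$ be the translate $B\mapsto\mu(B+p)$. For $I\subseteq\mathbb{R}$ put \[\|\mu\|_I:=\sup\Bigl\{\Bigl|\int u\,d\mu\Bigr| : u\in W^1_\infty(\mathbb{R}),\ \operatorname{spt}u\subseteq I,\ \operatorname{diam}\operatorname{spt}u\le 2,\ \|u'\|_\infty\le 1\Bigr\}.\] Let $a\colon\mathbb{R}\to\mathbb{C}$ be in $L_\infty(\mathbb{R})$, nonzero almost everywhere, with $\frac1a\in L_\infty(\mathbb{R})$, and let $\mu$ be a local measure with $\|\mu\|_{\mathrm{unif}}<\infty$. Let $H_{a,\mu}$ be the operator in $C_0(\mathbb{R})$ (complex-valued continuous functions tending to $0$ at $\pm\infty$) given by \[D(H_{a,\mu}):=\{u\in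 C_0(\mathbb{R})\cap W^1_{1,\mathrm{loc}}(\mathbb{R}) : -\partial a\partial u+u\mu\in C_0(\mathbb{R})\},\qquad H_{a,\mu}u:=-\partial a\partial u+u\mu,\] in the sense of distributions. Assume that for every $C>0$ there is a sequence $(p_m)$ in $(0,\infty)$ with $p_m\to\infty$ and \[e^{Cp_m}\Bigl(\|a-a(\cdot+p_m)\|_{L_1(-p_m,p_m)}+\|\mu-\mu(\cdot+p_m)\|_{[-p_m,p_m]}\Bigr)\to0\qquad(m\to\infty).\] Then $H_{a,\mu}$ has no eigenvalues: there are no $z\in\mathbb{C}$ and $0\ne u\in D(H_{a,\mu})$ with $H_{a,\mu}u=zu$. -/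

import Mathlib

open MeasureTheory Filter Topology Set
open scoped ENNReal ContDiff ZeroAtInfty

/-- A local measure on `ℝ`: a complex-valued function on the bounded Borel sets that is countably
additive (as long as the union stays bounded). Equivalently, `B ↦ μ (B ∩ K)` is a complex measure on
`ℝ` for every compact `K`. As for Mathlib's `VectorMeasure`, the function is extended by the value
`0` to all other sets, so that a local measure is determined by its values. -/
structure LocalMeasure where
  /-- The measure of a bounded Borel set. -/
  toFun : Set ℝ → ℂ
  eq_zero_of_not' : ∀ B : Set ℝ, ¬ (MeasurableSet B ∧ Bornology.IsBounded B) → toFun B = 0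
  empty' : toFun ∅ = 0
  hasSum_iUnion' : ∀ f : ℕ → Set ℝ, (∀ i, MeasurableSet (f i)) → Pairwise (Function.onFun Disjoint f) →
    Bornology.IsBounded (⋃ i, f i) → HasSum (fun i => toFun (f i)) (toFun (⋃ i, f i))

namespace LocalMeasure

instance : Sub LocalMeasure where
  sub μ ν :=
    { toFun := fun B => μ.toFun B - ν.toFun B
      eq_zero_of_not' := fun B hB => by
        rw [μ.eq_zero_of_not' B hB, ν.eq_zero_of_not' B hB, sub_zero]
      empty' := by rw [μ.empty', ν.empty', sub_zero]
      hasSum_iUnion' := fun f hf hd hb =>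
        (μ.hasSum_iUnion' f hf hd hb).sub (ν.hasSum_iUnion' f hf hd hb) }

theorem measurableSet_isBounded_preimage_iff (p : ℝ) (B : Set ℝ) :
    (MeasurableSet ((fun x => x - p) ⁻¹' B) ∧ Bornology.IsBounded ((fun x => x - p) ⁻¹' B)) ↔
      (MeasurableSet B ∧ Bornology.IsBounded B) := by
  have key : ∀ (q : ℝ) (A : Set ℝ), MeasurableSet A ∧ Bornology.IsBounded A →
      MeasurableSet ((fun x => x - q) ⁻¹' A) ∧ Bornology.IsBounded ((fun x => x - q) ⁻¹' A) := by
    rintro q A ⟨hm, hb⟩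
    refine ⟨(measurable_id.sub_const q) hm, ?_⟩
    obtain ⟨R, hR⟩ := hb.exists_norm_le
    refine isBounded_iff_forall_norm_le.2 ⟨R + ‖q‖, fun x hx => ?_⟩
    have h1 := hR (x - q) hx
    have h2 := norm_add_le (x - q) q
    rw [sub_add_cancel] at h2
    linarith
  refine ⟨fun h => ?_, key p B⟩
  have h' := key (-p) _ h
  have he : (fun x : ℝ => x - -p) ⁻¹' ((fun x => x - p) ⁻¹' B) = B := by
    ext x; simp
  rwa [he] at h'

/-- The translate `μ(· + p)`, that is `B ↦ μ (B + p)`; the set `B + p` is written as the preimage of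
`B` under `x ↦ x - p`. If `μ` has the density `ρ`, then `μ(· + p)` has the density `ρ(· + p)`. -/
def translate (μ : LocalMeasure) (p : ℝ) : LocalMeasure where
  toFun B := μ.toFun ((fun x => x - p) ⁻¹' B)
  eq_zero_of_not' B hB :=
    μ.eq_zero_of_not' _ (fun h => hB ((measurableSet_isBounded_preimage_iff p B).1 h))
  empty' := by rw [preimage_empty, μ.empty']
  hasSum_iUnion' f hf hd hb := by
    have hm : MeasurableSet (⋃ i, f i) := MeasurableSet.iUnion hf
    have hb' := ((measurableSet_isBounded_preimage_iff p (⋃ i, f i)).2 ⟨hm, hb⟩).2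
    rw [preimage_iUnion] at hb' ⊢
    exact μ.hasSum_iUnion' (fun i => (fun x => x - p) ⁻¹' f i)
      (fun i => (measurable_id.sub_const p) (hf i))
      (fun i j hij => (hd hij).preimage _) hb'

open scoped Classical in
/-- The complex measure `𝟙_K μ = μ(· ∩ K)` for a bounded Borel set `K` (and `0` otherwise). -/
noncomputable def restr (μ : LocalMeasure) (K : Set ℝ) : ComplexMeasure ℝ where
  measureOf' A := if MeasurableSet A ∧ MeasurableSet K ∧ Bornology.IsBounded K
    then μ.toFun (A ∩ K) else 0
  empty' := by simp [μ.empty']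
  not_measurable' A hA := by simp [hA]
  m_iUnion' f hf hd := by
    by_cases hK : MeasurableSet K ∧ Bornology.IsBounded K
    · have hU : MeasurableSet (⋃ i, f i) := MeasurableSet.iUnion hf
      simp only [hf, hU, hK, and_self, if_true, iUnion_inter]
      refine μ.hasSum_iUnion' (fun i => f i ∩ K) (fun i => (hf i).inter hK.1)
        (fun i j hij => (hd hij).mono inter_subset_left inter_subset_left)
        (hK.2.subset (iUnion_subset fun i => inter_subset_right))
    · simp [hK, hasSum_zero]

/-- The total variation `|μ|(B) = |𝟙_B μ|(ℝ)` of a bounded Borel set `B`. -/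
noncomputable def totalVariation (μ : LocalMeasure) (B : Set ℝ) : ℝ≥0∞ :=
  (μ.restr B).variation univ

/-- `‖μ‖_unif = sup_x |μ|((x, x + 1])`. -/
noncomputable def unifNorm (μ : LocalMeasure) : ℝ≥0∞ :=
  ⨆ x : ℝ, μ.totalVariation (Ioc x (x + 1))

/-- `∫ f dμ` for a continuous function `f` with compact support, computed as the integral of `f`
against the complex measure `𝟙_{spt f} μ`. -/
noncomputable def integral (μ : LocalMeasure) (f : ℝ → ℂ) : ℂ :=
  (μ.restr (tsupport f)).integral f (ContinuousLinearMap.mul ℝ ℂ)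

/-- The weak norm `‖μ‖_I`: the supremum of `|∫ u dμ|` over all `u ∈ W^1_∞(ℝ)` with `spt u ⊆ I`,
`diam (spt u) ≤ 2` and `‖u'‖_∞ ≤ 1`. These `u` are the `1`-Lipschitz functions with these
properties of the support; they are bounded since their support is. -/
noncomputable def weakNorm (μ : LocalMeasure) (I : Set ℝ) : ℝ≥0∞ :=
  ⨆ (u : ℝ → ℂ) (_ : LipschitzWith 1 u) (_ : tsupport u ⊆ I) (_ : Metric.ediam (tsupport u) ≤ 2),
    ‖μ.integral u‖ₑ

end LocalMeasure

/-- Complex-valued test functions on `ℝ`, the elements of `C_c^∞(ℝ)`. -/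
def IsTestFunction (φ : ℝ → ℂ) : Prop := ContDiff ℝ ∞ φ ∧ HasCompactSupport φ

/-- `u ∈ W^1_{1,loc}(ℝ)` with weak derivative `∂u = g`. -/
def IsWeakDeriv (u g : ℝ → ℂ) : Prop :=
  LocallyIntegrable u ∧ LocallyIntegrable g ∧
    ∀ φ : ℝ → ℂ, IsTestFunction φ → ∫ x, u x * deriv φ x = -∫ x, g x * φ x

/-- The operator `H_{a,μ} = -∂ a ∂ + μ` in `C₀(ℝ)`, given by its graph: `(u, f)` belongs to it iff
`u, f ∈ C₀(ℝ)`, `u ∈ W^1_{1,loc}(ℝ)` and `-∂ a ∂ u + u μ = f` in the sense of distributions. -/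
def sturmLiouville (a : ℝ → ℂ) (μ : LocalMeasure) : Set (C₀(ℝ, ℂ) × C₀(ℝ, ℂ)) :=
  {uf | ∃ g : ℝ → ℂ, IsWeakDeriv uf.1 g ∧ ∀ φ : ℝ → ℂ, IsTestFunction φ →
    (∫ x, a x * g x * deriv φ x) + μ.integral (fun x => uf.1 x * φ x) = ∫ x, uf.2 x * φ x}

/-- `z` is an eigenvalue of the operator in `C₀(ℝ)` with graph `H`: there is `u ≠ 0` in the domain
of `H` with `H u = z u`. -/
def IsEigenvalue (H : Set (C₀(ℝ, ℂ) × C₀(ℝ, ℂ))) (z : ℂ) : Prop :=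
  ∃ u : C₀(ℝ, ℂ), u ≠ 0 ∧ (u, z • u) ∈ H

/-- The approximation condition with exponential rate `C` along the sequence `p`:
`e^{C p_m} (‖a - a(· + p_m)‖_{L_1(-p_m, p_m)} + ‖μ - μ(· + p_m)‖_{[-p_m, p_m]}) → 0`. -/
def ExpApprox (a : ℝ → ℂ) (μ : LocalMeasure) (C : ℝ) (p : ℕ → ℝ) : Prop :=
  Tendsto (fun m => ENNReal.ofReal (Real.exp (C * p m)) *
    (eLpNorm (fun x => a x - a (x + p m)) 1 (volume.restrict (Ioo (-p m) (p m))) +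
      (μ - μ.translate (p m)).weakNorm (Icc (-p m) (p m)))) atTop (𝓝 0)

/-! The proof is a form of Gordon's argument, carried out for a first-order system with bounded
coefficients.

Reduction. With `F` the distribution function of `μ`, put `ρ(t) = F(t+1) - F(t)` and `N(t) = F(t) -
∫_t^{t+1} F`. Then `μ = N' + ρ`, and both functions are bounded by `‖μ‖_unif`. If `H u = z u`, the
quasi-derivative `v = a u' - N u` is absolutely continuous, and with `b = 1/a` the pair `y = (u, v)`
solves `u' = bN u + b v`, `v' = (ρ - z - bN²) u - bN v` (`exists_isSystemSolution`). The measure has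
disappeared, and the system has trace zero. Duality turns the weak norm of `μ - μ(· + p)` into `L¹`
bounds for the differences of `N` and `ρ` (`norm_integral_dens_reg_le`). Hence the coefficients are
`L¹`-close to their translates by `p` on `(-p, p - 2)`; the margin 2 is the length of the test
windows (`integral_coeffDist_le`).

Gordon's argument. For exactly `p`-periodic coefficients the monodromy matrix `T` has determinant
one, so `T + T⁻¹ = τ · 1`, that is, `y(t+p) + y(t-p) = τ y(t)`. Approximately: trace zero makes the
Wronskian of `y` and `y(· + p)` almost constant on `[-p, 0]`, so `y(p) + y(-p)` is nearly a multiple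
`τ y(0)` (`norm_det_le`, `exists_scalar_of_det_small`). This relation propagates to time `p - 2`,
giving `y(2p-2) + y(-2) ≈ τ y(p-2)` (`translates_le`). The Grönwall losses are exponential in `p`
and are beaten by the assumed rate.

Decay. Only `u → 0` is known, but `b ≠ 0` a.e. lets one recover `v` from `u` on a unit window,
uniformly over translations that nearly preserve `b` (`observability`). So `y` tends to zero at `p`,
`-p`, `p - 2` and `2p - 2`. The first two force `τ → 0`, the others then give `y(-2) = 0`, and
uniqueness gives `u = 0`. -/

/-! ### Calculus of absolutely continuous functions -/

/-- `f` is absolutely continuous on compact intervals with derivative `g`, expressed through the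
fundamental theorem of calculus. -/
def IsPrimitive (f g : ℝ → ℂ) : Prop :=
  LocallyIntegrable g ∧ ∀ s t, ∫ x in s..t, g x = f t - f s

theorem MeasureTheory.LocallyIntegrable.intervalIntegrable' {g : ℝ → ℂ} (hg : LocallyIntegrable g)
    (s t : ℝ) : IntervalIntegrable g volume s t :=
  (hg.integrableOn_isCompact isCompact_uIcc).intervalIntegrable

theorem isPrimitive_intervalIntegral {g : ℝ → ℂ} (hg : LocallyIntegrable g) (c : ℂ) (s : ℝ) :
    IsPrimitive (fun t => c + ∫ x in s..t, g x) g := by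
  refine ⟨hg, fun r t => ?_⟩
  rw [add_sub_add_left_eq_sub, intervalIntegral.integral_interval_sub_left] <;>
    exact hg.intervalIntegrable' _ _

theorem MeasureTheory.LocallyIntegrable.absolutelyContinuousOnInterval_integral {g : ℝ → ℂ}
    (hg : LocallyIntegrable g) (a b : ℝ) :
    AbsolutelyContinuousOnInterval (fun t => ∫ x in a..t, g x) a b := by
  have hre : ∀ c d, IntervalIntegrable (fun x => (g x).re) volume c d := fun c d =>
    ⟨(hg.intervalIntegrable' c d).1.re, (hg.intervalIntegrable' c d).2.re⟩
  have him : ∀ c d, IntervalIntegrable (fun x => (g x).im) volume c d := fun c d =>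
    ⟨(hg.intervalIntegrable' c d).1.im, (hg.intervalIntegrable' c d).2.im⟩
  have hc : ∀ c : ℂ, AbsolutelyContinuousOnInterval (fun _ : ℝ => c) a b := fun c =>
    (LipschitzWith.const c).lipschitzOnWith.absolutelyContinuousOnInterval
  have h1 := ((hre a b).absolutelyContinuousOnInterval_intervalIntegral left_mem_uIcc).smul (hc 1)
  have h2 := ((him a b).absolutelyContinuousOnInterval_intervalIntegral left_mem_uIcc).smul
    (hc Complex.I)
  convert! h1.add h2 using 1
  ext1 t
  have hre' := hre a t
  have him' := him a t
  simp only [Pi.add_apply, Pi.smul_apply', Complex.real_smul, mul_one]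
  rw [← intervalIntegral.integral_ofReal, ← intervalIntegral.integral_ofReal,
    ← intervalIntegral.integral_mul_const, ← intervalIntegral.integral_add]
  · simp only [Complex.re_add_im]
  · exact ⟨hre'.1.ofReal, hre'.2.ofReal⟩
  · exact (IntervalIntegrable.mul_const ⟨him'.1.ofReal, him'.2.ofReal⟩ _)

namespace IsPrimitive

variable {f g f₁ g₁ f₂ g₂ : ℝ → ℂ}

theorem absolutelyContinuousOnInterval (h : IsPrimitive f g) (a b : ℝ) :
    AbsolutelyContinuousOnInterval f a b := by
  have h1 := h.1.absolutelyContinuousOnInterval_integral a b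
  have hc : AbsolutelyContinuousOnInterval (fun _ : ℝ => f a) a b :=
    (LipschitzWith.const (f a)).lipschitzOnWith.absolutelyContinuousOnInterval
  convert! hc.add h1 using 1
  ext1 t
  simp [h.2]

theorem ae_hasDerivAt (h : IsPrimitive f g) : ∀ᵐ x, HasDerivAt f (g x) x := by
  filter_upwards [LocallyIntegrable.ae_hasDerivAt_integral h.1] with x hx
  have := (hx 0).const_add (f 0)
  refine this.congr_of_eventuallyEq (Eventually.of_forall fun t => ?_)
  simp [h.2]

theorem continuous (h : IsPrimitive f g) : Continuous f := by
  have h1 : Continuous fun t => ∫ x in (0 : ℝ)..t, g x :=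
    intervalIntegral.continuous_primitive (fun a b => h.1.intervalIntegrable' a b) 0
  convert h1.add (continuous_const (y := f 0)) using 1
  ext t
  simp [h.2]

theorem congr_ae {g' : ℝ → ℂ} (h : IsPrimitive f g) (hg : g =ᵐ[volume] g') : IsPrimitive f g' := by
  refine ⟨(locallyIntegrable_congr hg).1 h.1, fun s t => ?_⟩
  rw [← h.2 s t]
  exact intervalIntegral.integral_congr_ae (hg.mono fun x hx _ => hx.symm)

theorem add (h₁ : IsPrimitive f₁ g₁) (h₂ : IsPrimitive f₂ g₂) :
    IsPrimitive (fun x => f₁ x + f₂ x) (fun x => g₁ x + g₂ x) := by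
  refine ⟨h₁.1.add h₂.1, fun s t => ?_⟩
  rw [intervalIntegral.integral_add (h₁.1.intervalIntegrable' s t) (h₂.1.intervalIntegrable' s t),
    h₁.2, h₂.2]
  ring

theorem const_mul (h : IsPrimitive f g) (c : ℂ) :
    IsPrimitive (fun x => c * f x) (fun x => c * g x) := by
  refine ⟨h.1.smul c, fun s t => ?_⟩
  rw [intervalIntegral.integral_const_mul, h.2]
  ring

theorem sub (h₁ : IsPrimitive f₁ g₁) (h₂ : IsPrimitive f₂ g₂) :
    IsPrimitive (fun x => f₁ x - f₂ x) (fun x => g₁ x - g₂ x) := by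
  convert h₁.add (h₂.const_mul (-1)) using 2 <;> ring

theorem comp_add_right (h : IsPrimitive f g) (p : ℝ) :
    IsPrimitive (fun x => f (x + p)) (fun x => g (x + p)) := by
  refine ⟨?_, fun s t => ?_⟩
  · intro x
    obtain ⟨U, hU, hi⟩ := h.1 (x + p)
    refine ⟨(fun y => y + p) ⁻¹' U, (by fun_prop : Continuous fun y : ℝ => y + p).continuousAt.preimage_mem_nhds hU, ?_⟩
    exact ((measurePreserving_add_right (volume : Measure ℝ) p).integrableOn_comp_preimage
      (measurableEmbedding_addRight p)).2 hi
  · rw [intervalIntegral.integral_comp_add_right (fun x => g x), h.2]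

/-- The product minus the primitive of the proposed derivative is absolutely continuous with
derivative zero a.e., hence constant on every interval. -/
theorem mul (h₁ : IsPrimitive f₁ g₁) (h₂ : IsPrimitive f₂ g₂) :
    IsPrimitive (fun x => f₁ x * f₂ x) (fun x => g₁ x * f₂ x + f₁ x * g₂ x) := by
  have hloc : LocallyIntegrable (fun x => g₁ x * f₂ x + f₁ x * g₂ x) :=
    (h₁.1.mul_continuous h₂.continuous).add (h₂.1.continuous_mul h₁.continuous)
  refine ⟨hloc, fun s t => ?_⟩
  have hP := isPrimitive_intervalIntegral hloc 0 s
  have hac := ((h₁.absolutelyContinuousOnInterval s t).smul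
    (h₂.absolutelyContinuousOnInterval s t)).sub (hP.absolutelyContinuousOnInterval s t)
  obtain ⟨C, hC⟩ := hac.const_of_ae_hasDerivAt_zero (by
    filter_upwards [h₁.ae_hasDerivAt, h₂.ae_hasDerivAt, hP.ae_hasDerivAt] with x hx₁ hx₂ hx₃ _
    have h := (hx₁.mul hx₂).sub hx₃
    rw [sub_self] at h
    exact h)
  have h1 := hC s left_mem_uIcc
  have h2 := hC t right_mem_uIcc
  simp at h1 h2
  beta_reduce
  rw [h1, ← h2]
  ring

theorem integral_eq_zero (h : IsPrimitive f g) {a b : ℝ} (hab : a ≤ b) (hfa : f a = 0)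
    (hfb : f b = 0) (hg : ∀ x, x ∉ Ioc a b → g x = 0) : ∫ x, g x = 0 := by
  have h1 := h.2 a b
  rw [hfa, hfb, sub_zero, intervalIntegral.integral_of_le hab] at h1
  rw [← h1]
  exact (setIntegral_eq_integral_of_forall_compl_eq_zero hg).symm

end IsPrimitive

/-! ### Grönwall estimates -/

/-- The right-hand side `R` of the integral inequality satisfies `R' = K f ≤ K R`, so the
differential Grönwall inequality applies to `R`, which dominates `f`. -/
theorem le_mul_exp_of_le_add_mul_integral {f : ℝ → ℝ} (hf : Continuous f) {δ K s t : ℝ}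
    (hK : 0 ≤ K) (hst : s ≤ t) (h : ∀ r ∈ Icc s t, f r ≤ δ + K * ∫ x in s..r, f x) :
    f t ≤ δ * Real.exp (K * (t - s)) := by
  have hd : ∀ r, HasDerivAt (fun r => δ + K * ∫ x in s..r, f x) (K * f r) r := fun r =>
    ((hf.integral_hasStrictDerivAt s r).hasDerivAt.const_mul K).const_add δ
  have := le_gronwallBound_of_liminf_deriv_right_le (f := fun r => δ + K * ∫ x in s..r, f x)
    (f' := fun r => K * f r) (δ := δ) (K := K) (ε := 0) (a := s) (b := t)
    (fun r _ => (hd r).continuousAt.continuousWithinAt)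
    (fun r _ q hq => ((hd r).hasDerivWithinAt (s := Ici r)).liminf_right_slope_le hq)
    (by simp) (fun r hr => by
      rw [add_zero]
      exact mul_le_mul_of_nonneg_left (h r ⟨hr.1, hr.2.le⟩) hK) t ⟨hst, le_rfl⟩
  rw [gronwallBound_ε0] at this
  exact (h t ⟨hst, le_rfl⟩).trans this

/-- Grönwall's inequality in integral form, in both directions of time. -/
theorem le_mul_exp_of_le_add_mul_abs_integral {f : ℝ → ℝ} (hf : Continuous f) {δ K s t : ℝ}
    (hf0 : ∀ x, 0 ≤ f x)
    (hK : 0 ≤ K) (h : ∀ r ∈ uIcc s t, f r ≤ δ + K * |∫ x in s..r, f x|) :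
    f t ≤ δ * Real.exp (K * |t - s|) := by
  rcases le_total s t with hst | hst
  · rw [abs_of_nonneg (sub_nonneg.2 hst)]
    refine le_mul_exp_of_le_add_mul_integral hf hK hst fun r hr => ?_
    rw [uIcc_of_le hst] at h
    have := h r hr
    rwa [abs_of_nonneg (intervalIntegral.integral_nonneg hr.1 fun x _ => hf0 x)] at this
  · rw [abs_of_nonpos (sub_nonpos.2 hst), neg_sub]
    have := le_mul_exp_of_le_add_mul_integral (f := fun x => f (-x)) (hf.comp continuous_neg)
      (δ := δ) hK (neg_le_neg hst) fun r hr => ?_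
    · simpa [sub_eq_add_neg, add_comm] using this
    · rw [uIcc_of_ge hst] at h
      have := h (-r) ⟨by linarith [hr.2], by linarith [hr.1]⟩
      rw [intervalIntegral.integral_comp_neg, neg_neg]
      rwa [intervalIntegral.integral_symm, abs_neg, abs_of_nonneg
        (intervalIntegral.integral_nonneg (by linarith [hr.1]) fun x _ => hf0 x)] at this

/-- Growth of solutions of the planar system `y₁' = α y₁ + β y₂ + e₁`, `y₂' = γ y₁ - α y₂ + e₂`. -/
theorem norm_add_norm_le_of_system {α β γ e₁ e₂ y₁ y₂ : ℝ → ℂ} {e : ℝ → ℝ} {L s t η : ℝ}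
    (hα : ∀ x, ‖α x‖ ≤ L) (hβ : ∀ x, ‖β x‖ ≤ L) (hγ : ∀ x, ‖γ x‖ ≤ L)
    (h₁ : IsPrimitive y₁ fun x => α x * y₁ x + β x * y₂ x + e₁ x)
    (h₂ : IsPrimitive y₂ fun x => γ x * y₁ x - α x * y₂ x + e₂ x)
    (hei : LocallyIntegrable e)
    (he : ∀ x ∈ uIcc s t, ‖e₁ x‖ + ‖e₂ x‖ ≤ e x) (hη : |∫ x in s..t, e x| ≤ η) :
    ‖y₁ t‖ + ‖y₂ t‖ ≤ (‖y₁ s‖ + ‖y₂ s‖ + η) * Real.exp (2 * L * |t - s|) := by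
  have hc₁ := h₁.continuous
  have hc₂ := h₂.continuous
  have hL : 0 ≤ L := (norm_nonneg _).trans (hα 0)
  refine le_mul_exp_of_le_add_mul_abs_integral (f := fun x => ‖y₁ x‖ + ‖y₂ x‖) (by fun_prop)
    (fun x => by positivity) (by positivity) fun r hr => ?_
  have hsub : uIcc s r ⊆ uIcc s t := uIcc_subset_uIcc_left hr
  have hee : ∀ a b, IntervalIntegrable e volume a b := fun a b =>
    (hei.integrableOn_isCompact isCompact_uIcc).intervalIntegrable
  have hff : ∀ a b, IntervalIntegrable (fun x => ‖y₁ x‖ + ‖y₂ x‖) volume a b := fun a b =>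
    (by fun_prop : Continuous fun x => ‖y₁ x‖ + ‖y₂ x‖).intervalIntegrable a b
  set g₁ := fun x => α x * y₁ x + β x * y₂ x + e₁ x with hg₁
  set g₂ := fun x => γ x * y₁ x - α x * y₂ x + e₂ x with hg₂
  have hn₁ := (h₁.1.intervalIntegrable' s r).norm
  have hn₂ := (h₂.1.intervalIntegrable' s r).norm
  have b₁ : ‖y₁ r‖ ≤ ‖y₁ s‖ + ‖∫ x in s..r, g₁ x‖ := by
    rw [h₁.2]; linarith [norm_sub_norm_le (y₁ r) (y₁ s)]
  have b₂ : ‖y₂ r‖ ≤ ‖y₂ s‖ + ‖∫ x in s..r, g₂ x‖ := by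
    rw [h₂.2]; linarith [norm_sub_norm_le (y₂ r) (y₂ s)]
  have hpt : ∀ x ∈ uIcc s t, ‖g₁ x‖ + ‖g₂ x‖ ≤ e x + 2 * L * (‖y₁ x‖ + ‖y₂ x‖) := by
    intro x hx
    have i₁ : ‖g₁ x‖ ≤ ‖α x‖ * ‖y₁ x‖ + ‖β x‖ * ‖y₂ x‖ + ‖e₁ x‖ := by
      rw [← norm_mul, ← norm_mul]; exact norm_add₃_le
    have i₂ : ‖g₂ x‖ ≤ ‖γ x‖ * ‖y₁ x‖ + ‖α x‖ * ‖y₂ x‖ + ‖e₂ x‖ := by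
      rw [← norm_mul, ← norm_mul]
      exact (norm_add_le _ _).trans (by gcongr; exact norm_sub_le _ _)
    have := he x hx
    have := mul_le_mul_of_nonneg_right (hα x) (norm_nonneg (y₁ x))
    have := mul_le_mul_of_nonneg_right (hα x) (norm_nonneg (y₂ x))
    have := mul_le_mul_of_nonneg_right (hβ x) (norm_nonneg (y₂ x))
    have := mul_le_mul_of_nonneg_right (hγ x) (norm_nonneg (y₁ x))
    linarith
  have e0 : ∀ x ∈ uIcc s t, 0 ≤ e x := fun x hx => le_trans (by positivity) (he x hx)
  have hmem : ∀ x ∈ uIoc s r, x ∈ uIcc s t := fun x hx => hsub (uIoc_subset_uIcc hx)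
  have hIt : uIoc s r ⊆ uIoc s t := uIoc_subset_uIoc_of_uIcc_subset_uIcc hsub
  have key : ‖∫ x in s..r, g₁ x‖ + ‖∫ x in s..r, g₂ x‖ ≤
      |∫ x in s..t, e x| + 2 * L * |∫ x in s..r, ‖y₁ x‖ + ‖y₂ x‖| := by
    calc _ ≤ (∫ x in uIoc s r, ‖g₁ x‖) + ∫ x in uIoc s r, ‖g₂ x‖ :=
          add_le_add intervalIntegral.norm_integral_le_integral_norm_uIoc
            intervalIntegral.norm_integral_le_integral_norm_uIoc
      _ = ∫ x in uIoc s r, (‖g₁ x‖ + ‖g₂ x‖) := (integral_add hn₁.def' hn₂.def').symm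
      _ ≤ ∫ x in uIoc s r, (e x + 2 * L * (‖y₁ x‖ + ‖y₂ x‖)) :=
          setIntegral_mono_on (hn₁.def'.add hn₂.def')
            ((hee s r).def'.add ((hff s r).const_mul _).def') measurableSet_uIoc
            fun x hx => hpt x (hmem x hx)
      _ = (∫ x in uIoc s r, e x) + 2 * L * ∫ x in uIoc s r, (‖y₁ x‖ + ‖y₂ x‖) := by
          rw [integral_add (hee s r).def' ((hff s r).const_mul _).def', integral_const_mul]
      _ ≤ (∫ x in uIoc s t, e x) + 2 * L * |∫ x in s..r, (‖y₁ x‖ + ‖y₂ x‖)| := by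
          rw [intervalIntegral.abs_integral_eq_abs_integral_uIoc]
          refine add_le_add (setIntegral_mono_set (hee s t).def'
              ((ae_restrict_iff' measurableSet_uIoc).2
                (Eventually.of_forall fun x hx => e0 x (uIoc_subset_uIcc hx))) hIt.eventuallyLE)
            (mul_le_mul_of_nonneg_left (le_abs_self _) (by positivity))
      _ ≤ _ := by
          rw [intervalIntegral.abs_integral_eq_abs_integral_uIoc e]
          gcongr
          exact le_abs_self _
  linarith

/-! ### Trace-zero planar systems: growth and observability -/

/-- `(u, v)` solves the planar system `u' = α u + β v`, `v' = γ u - α v` of trace zero, with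
coefficients bounded by `L`. -/
structure IsSystemSolution (α β γ : ℝ → ℂ) (L : ℝ) (u v : ℝ → ℂ) : Prop where
  locInt_α : LocallyIntegrable α
  locInt_β : LocallyIntegrable β
  locInt_γ : LocallyIntegrable γ
  bound_α : ∀ x, ‖α x‖ ≤ L
  bound_β : ∀ x, ‖β x‖ ≤ L
  bound_γ : ∀ x, ‖γ x‖ ≤ L
  prim_u : IsPrimitive u fun x => α x * u x + β x * v x
  prim_v : IsPrimitive v fun x => γ x * u x - α x * v x

/-- The pointwise distance of the coefficients of a system to their translates by `p`. -/
noncomputable def coeffDist (α β γ : ℝ → ℂ) (p x : ℝ) : ℝ :=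
  ‖α (x + p) - α x‖ + ‖β (x + p) - β x‖ + ‖γ (x + p) - γ x‖

theorem MeasureTheory.LocallyIntegrable.comp_add_right {E : Type*} [NormedAddCommGroup E]
    {f : ℝ → E} (h : LocallyIntegrable f) (p : ℝ) : LocallyIntegrable fun x => f (x + p) := by
  intro x
  obtain ⟨U, hU, hi⟩ := h (x + p)
  refine ⟨(fun y => y + p) ⁻¹' U,
    (by fun_prop : Continuous fun y : ℝ => y + p).continuousAt.preimage_mem_nhds hU, ?_⟩
  exact ((measurePreserving_add_right (volume : Measure ℝ) p).integrableOn_comp_preimage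
    (measurableEmbedding_addRight p)).2 hi

theorem MeasureTheory.LocallyIntegrable.norm_translate_sub {f : ℝ → ℂ} (h : LocallyIntegrable f)
    (p : ℝ) : LocallyIntegrable fun x => ‖f (x + p) - f x‖ := fun x => by
  obtain ⟨U, hU, hi⟩ := ((h.comp_add_right p).sub h) x
  exact ⟨U, hU, hi.norm⟩

namespace IsSystemSolution

variable {α β γ u v : ℝ → ℂ} {L : ℝ}

theorem L_nonneg (h : IsSystemSolution α β γ L u v) : 0 ≤ L :=
  (norm_nonneg _).trans (h.bound_α 0)

theorem growth (h : IsSystemSolution α β γ L u v) (s t : ℝ) :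
    ‖u t‖ + ‖v t‖ ≤ (‖u s‖ + ‖v s‖) * Real.exp (2 * L * |t - s|) := by
  have := norm_add_norm_le_of_system (e₁ := 0) (e₂ := 0) (e := 0) (s := s) (t := t) (η := 0)
    h.bound_α h.bound_β h.bound_γ
    (by simpa using h.prim_u) (by simpa using h.prim_v) locallyIntegrable_zero (by simp) (by simp)
  simpa using this

/-- Uniqueness for the initial value problem: the growth bound starting from zero data. -/
theorem eq_zero (h : IsSystemSolution α β γ L u v) {s : ℝ} (hu : u s = 0) (hv : v s = 0) :
    u = 0 := by
  ext t
  have := h.growth s t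
  rw [hu, hv] at this
  simp only [norm_zero, add_zero, zero_mul] at this
  have h2 := norm_nonneg (v t)
  exact norm_le_zero_iff.1 (by linarith)

theorem locallyIntegrable_coeffDist (h : IsSystemSolution α β γ L u v) (p : ℝ) :
    LocallyIntegrable (coeffDist α β γ p) :=
  ((h.locInt_α.norm_translate_sub p).add (h.locInt_β.norm_translate_sub p)).add
    (h.locInt_γ.norm_translate_sub p)

theorem coeffDist_nonneg (p x : ℝ) : 0 ≤ coeffDist α β γ p x := by
  unfold coeffDist; positivity

/-- If `u` is small on a window where `β` is close to its translate, then `v` is small as well. -/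
theorem observability (h : IsSystemSolution α β γ L u v) (hβ : ∀ᵐ x, β x ≠ 0) (s : ℝ) :
    ∃ κ > 0, ∃ η > 0, ∀ q ε : ℝ, ∫ x in s..s + 1, ‖β (x + q) - β x‖ ≤ η →
      (∀ t ∈ Icc s (s + 1), ‖u (t + q)‖ ≤ ε) → ‖u (s + q)‖ + ‖v (s + q)‖ ≤ κ * ε := by
  have hL := h.L_nonneg
  -- At a point where the primitive of `β` has derivative `β s₁ ≠ 0`, the integral of `β` over a
  -- short interval to the right of `s₁` is comparable to its length.
  obtain ⟨s₁, ⟨hs₁, hds₁⟩, hβs₁⟩ : ∃ s₁, ((s₁ ∈ Ioo s (s + 1)) ∧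
      HasDerivAt (fun t => ∫ x in s..t, β x) (β s₁) s₁) ∧ β s₁ ≠ 0 := by
    have h1 : ∀ᵐ x ∂(volume.restrict (Ioo s (s + 1))), x ∈ Ioo s (s + 1) :=
      ae_restrict_mem measurableSet_Ioo
    have h2 := ae_restrict_of_ae (s := Ioo s (s + 1))
      (LocallyIntegrable.ae_hasDerivAt_integral h.locInt_β)
    have h3 := ae_restrict_of_ae (s := Ioo s (s + 1)) hβ
    have : NeBot (ae (volume.restrict (Ioo s (s + 1)))) := by
      rw [ae_neBot]
      intro h0
      have := congrArg (fun m => m univ) h0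
      simp at this
    exact (((h1.and (h2.mono fun x hx => hx s)).and h3)).exists
  set b := ‖β s₁‖ with hb
  have hb0 : 0 < b := norm_pos_iff.2 hβs₁
  set E := Real.exp (2 * L) with hE
  have hE1 : 1 ≤ E := Real.one_le_exp (by positivity)
  obtain ⟨h₀, hh₀, hder⟩ : ∃ h₀ > 0, ∀ k, 0 < k → k < h₀ →
      ‖(∫ x in s₁..s₁ + k, β x) - k • β s₁‖ ≤ b / 2 * k := by
    have := hds₁.isLittleO.def (half_pos hb0)
    rw [Metric.eventually_nhds_iff] at this
    obtain ⟨δ, hδ, hd⟩ := this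
    refine ⟨δ, hδ, fun k hk hkδ => ?_⟩
    have := hd (y := s₁ + k) (by simpa [abs_of_pos hk] using hkδ)
    rw [intervalIntegral.integral_interval_sub_left (h.locInt_β.intervalIntegrable' _ _)
      (h.locInt_β.intervalIntegrable' _ _)] at this
    simpa [abs_of_pos hk] using this
  -- The length `k` is small enough that the drift of `v` over `[s₁, s₁ + k]` can be absorbed below.
  -- It depends on `s` and the system, but not on the translation `q`.
  obtain ⟨k, hk0, hkh₀, hks, hkE⟩ : ∃ k > 0, k < h₀ ∧ s₁ + k ≤ s + 1 ∧
      E * L ^ 2 * k ≤ b / 8 := by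
    refine ⟨min (h₀ / 2) (min (s + 1 - s₁) (b / 8 / (E * L ^ 2 + 1))), ?_, ?_, ?_, ?_⟩
    · refine lt_min (by positivity) (lt_min (by linarith [hs₁.2]) (by positivity))
    · exact (min_le_left _ _).trans_lt (half_lt_self hh₀)
    · linarith [(min_le_right (h₀ / 2) _).trans
        (min_le_left (s + 1 - s₁) (b / 8 / (E * L ^ 2 + 1)))]
    · have h1 := (min_le_right (h₀ / 2) _).trans
        (min_le_right (s + 1 - s₁) (b / 8 / (E * L ^ 2 + 1)))
      have h2 : 0 ≤ E * L ^ 2 := by positivity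
      calc _ ≤ (E * L ^ 2) * (b / 8 / (E * L ^ 2 + 1)) := mul_le_mul_of_nonneg_left h1 h2
        _ ≤ (E * L ^ 2 + 1) * (b / 8 / (E * L ^ 2 + 1)) := by gcongr; linarith
        _ = b / 8 := by field_simp
  have hk1 : k ≤ 1 := by linarith [hs₁.1]
  refine ⟨E * (1 + 4 * (2 + k * L + k * b / 4) / (k * b)), by positivity, k * b / (8 * E),
    by positivity, fun q ε hD hε => ?_⟩
  have hε0 : 0 ≤ ε := (norm_nonneg _).trans (hε s ⟨le_rfl, by linarith⟩)
  set D := ∫ x in s..s + 1, ‖β (x + q) - β x‖ with hDdef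
  have hED : E * D ≤ k * b / 8 := by
    calc E * D ≤ E * (k * b / (8 * E)) := by gcongr
      _ = k * b / 8 := by field_simp
  set S := E * (‖u (s₁ + q)‖ + ‖v (s₁ + q)‖) with hS
  have hS0 : 0 ≤ S := by positivity
  have hmem : ∀ t ∈ Icc s₁ (s₁ + k), t ∈ Icc s (s + 1) := fun t ht =>
    ⟨hs₁.1.le.trans ht.1, ht.2.trans hks⟩
  have hSb : ∀ t ∈ Icc s₁ (s₁ + k), ‖u (t + q)‖ + ‖v (t + q)‖ ≤ S := by
    intro t ht
    refine (h.growth (s₁ + q) (t + q)).trans ?_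
    rw [hS, mul_comm]
    gcongr
    rw [hE]
    refine Real.exp_le_exp.2 ?_
    rw [abs_of_nonneg (by linarith [ht.1])]
    have : t + q - (s₁ + q) ≤ 1 := by linarith [ht.2]
    nlinarith
  have hu := h.prim_u.comp_add_right q
  have hv := h.prim_v.comp_add_right q
  have hvb : ∀ t ∈ Icc s₁ (s₁ + k), ‖v (t + q) - v (s₁ + q)‖ ≤ L * S * k := by
    intro t ht
    rw [← hv.2 s₁ t]
    refine (intervalIntegral.norm_integral_le_of_norm_le_const (C := L * S) fun x hx => ?_).trans ?_
    · rw [uIoc_of_le ht.1] at hx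
      have h1 := hSb x ⟨hx.1.le, hx.2.trans ht.2⟩
      calc _ ≤ ‖γ (x + q)‖ * ‖u (x + q)‖ + ‖α (x + q)‖ * ‖v (x + q)‖ := by
            rw [← norm_mul, ← norm_mul]; exact norm_sub_le _ _
        _ ≤ L * ‖u (x + q)‖ + L * ‖v (x + q)‖ := by
            gcongr
            exacts [h.bound_γ _, h.bound_α _]
        _ ≤ L * S := by rw [← mul_add]; gcongr
    · rw [abs_of_nonneg (by linarith [ht.1])]
      have : t - s₁ ≤ k := by linarith [ht.2]
      gcongr
  -- Integrating `u' = α u + β v` after freezing `v` at `s₁ + q` and replacing the translated `β` by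
  -- `β` expresses `v (s₁ + q)` through `u` and error terms.
  have hmain : v (s₁ + q) * ∫ x in s₁..s₁ + k, β x = (u (s₁ + k + q) - u (s₁ + q)) -
      ∫ x in s₁..s₁ + k, (α (x + q) * u (x + q) + (β (x + q) - β x) * v (x + q) +
        β x * (v (x + q) - v (s₁ + q))) := by
    rw [← hu.2 s₁ (s₁ + k), ← intervalIntegral.integral_const_mul,
      ← intervalIntegral.integral_sub (hu.1.intervalIntegrable' _ _)]
    · congr 1
      ext x
      ring
    · refine LocallyIntegrable.intervalIntegrable' ?_ _ _
      have cu := h.prim_u.comp_add_right q |>.continuous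
      have cv := h.prim_v.comp_add_right q |>.continuous
      exact (((h.locInt_α.comp_add_right q).mul_continuous cu).add
        (((h.locInt_β.comp_add_right q).sub h.locInt_β).mul_continuous cv)).add
          (h.locInt_β.mul_continuous (cv.sub continuous_const))
  have hrest : ‖∫ x in s₁..s₁ + k, (α (x + q) * u (x + q) + (β (x + q) - β x) * v (x + q) +
        β x * (v (x + q) - v (s₁ + q)))‖ ≤ k * (L * ε + L * (L * S * k)) + D * S := by
    have hii := fun a b => ((h.locInt_β.norm_translate_sub q).integrableOn_isCompact
      (isCompact_uIcc (a := a) (b := b))).intervalIntegrable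
    calc _ ≤ ∫ x in s₁..s₁ + k, (L * ε + L * (L * S * k) + ‖β (x + q) - β x‖ * S) := by
          refine intervalIntegral.norm_integral_le_of_norm_le (by linarith)
            (Eventually.of_forall fun x hx => ?_)
            (intervalIntegrable_const.add ((hii _ _).mul_const _))
          have hx' : x ∈ Icc s₁ (s₁ + k) := ⟨hx.1.le, hx.2⟩
          refine norm_add₃_le.trans ?_
          rw [norm_mul, norm_mul, norm_mul]
          have i1 := mul_le_mul (h.bound_α (x + q)) (hε x (hmem x hx')) (norm_nonneg _) hL
          have i2 := mul_le_mul (h.bound_β x) (hvb x hx') (norm_nonneg _) hL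
          have i3 : ‖β (x + q) - β x‖ * ‖v (x + q)‖ ≤ ‖β (x + q) - β x‖ * S := by
            gcongr
            linarith [hSb x hx', norm_nonneg (u (x + q))]
          linarith
      _ = k * (L * ε + L * (L * S * k)) + (∫ x in s₁..s₁ + k, ‖β (x + q) - β x‖) * S := by
          rw [intervalIntegral.integral_add intervalIntegrable_const ((hii _ _).mul_const _),
            intervalIntegral.integral_const, intervalIntegral.integral_mul_const]
          simp
      _ ≤ _ := by
          gcongr
          exact intervalIntegral.integral_mono_interval hs₁.1.le (by linarith) hks
            (Eventually.of_forall fun x => norm_nonneg _) (hii _ _)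
  have hβk : b / 2 * k ≤ ‖∫ x in s₁..s₁ + k, β x‖ := by
    have h1 := hder k hk0 hkh₀
    have h2 : ‖k • β s₁‖ = k * b := by rw [norm_smul, Real.norm_of_nonneg hk0.le]
    have h3 := norm_sub_norm_le (k • β s₁) (∫ x in s₁..s₁ + k, β x)
    rw [norm_sub_rev] at h3
    linarith
  have e1 := hε s₁ (hmem s₁ ⟨le_rfl, by linarith⟩)
  have e2 := hε (s₁ + k) (hmem _ ⟨by linarith, le_rfl⟩)
  have hvs : ‖v (s₁ + q)‖ * (b / 2 * k) ≤ 2 * ε + k * (L * ε + L * (L * S * k)) + D * S := by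
    calc _ ≤ ‖v (s₁ + q)‖ * ‖∫ x in s₁..s₁ + k, β x‖ := by gcongr
      _ ≤ ‖u (s₁ + k + q) - u (s₁ + q)‖ + _ := by
          rw [← norm_mul, hmain]; exact (norm_sub_le _ _).trans (by gcongr)
      _ ≤ _ := by linarith [norm_sub_le (u (s₁ + k + q)) (u (s₁ + q))]
  have hv₁ : ‖v (s₁ + q)‖ ≤ 4 * (2 + k * L + k * b / 4) / (k * b) * ε := by
    rw [div_mul_eq_mul_div, le_div_iff₀ (by positivity)]
    have hSε : S ≤ E * (ε + ‖v (s₁ + q)‖) := by rw [hS]; gcongr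
    -- The choices of `k` and `η` bound the errors proportional to `S` by half of the left side `b k
    -- / 2 * ‖v (s₁ + q)‖`, up to a multiple of `ε`.
    have j1 : (L ^ 2 * k ^ 2 + D) * S ≤ k * b / 4 * (ε + ‖v (s₁ + q)‖) := by
      have hD0 : 0 ≤ D := intervalIntegral.integral_nonneg (by linarith) fun _ _ => norm_nonneg _
      calc _ ≤ (L ^ 2 * k ^ 2 + D) * (E * (ε + ‖v (s₁ + q)‖)) := by gcongr
        _ = (E * L ^ 2 * k * k + E * D) * (ε + ‖v (s₁ + q)‖) := by ring
        _ ≤ (b / 8 * k + k * b / 8) * (ε + ‖v (s₁ + q)‖) := by gcongr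
        _ = _ := by ring
    linarith
  have hg := h.growth (s₁ + q) (s + q)
  have hexp : Real.exp (2 * L * |s + q - (s₁ + q)|) ≤ E := by
    rw [hE]
    refine Real.exp_le_exp.2 ?_
    rw [abs_of_nonpos (by linarith [hs₁.1])]
    have : -(s + q - (s₁ + q)) ≤ 1 := by linarith [hs₁.2]
    nlinarith
  calc _ ≤ _ := hg
    _ ≤ (ε + 4 * (2 + k * L + k * b / 4) / (k * b) * ε) * E := by gcongr
    _ = _ := by ring

end IsSystemSolution

/-! ### Gordon's argument -/

/-- Dividing by a nonzero component of `x` gives a `τ` that removes this component of `y` and leaves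
the determinant, up to a factor, in the other. The constant depends on `x` alone, so it serves all
periods at once. -/
theorem exists_scalar_of_det_small {x₁ x₂ : ℂ} (hx : ¬(x₁ = 0 ∧ x₂ = 0)) :
    ∃ c : ℝ, 0 ≤ c ∧ ∀ y₁ y₂ : ℂ, ∃ τ : ℂ, ‖τ‖ ≤ c * (‖y₁‖ + ‖y₂‖) ∧
      ‖y₁ - τ * x₁‖ + ‖y₂ - τ * x₂‖ ≤ c * ‖x₁ * y₂ - x₂ * y₁‖ := by
  by_cases h₁ : x₁ = 0
  · have h₂ : x₂ ≠ 0 := fun h₂ => hx ⟨h₁, h₂⟩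
    refine ⟨‖x₂‖⁻¹, by positivity, fun y₁ y₂ => ⟨y₂ / x₂, ?_, ?_⟩⟩
    · rw [norm_div, div_eq_inv_mul]
      gcongr
      linarith [norm_nonneg y₁]
    · have := norm_pos_iff.2 h₂
      rw [div_mul_cancel₀ _ h₂, h₁]
      simp [this.ne']
  · refine ⟨‖x₁‖⁻¹, by positivity, fun y₁ y₂ => ⟨y₁ / x₁, ?_, ?_⟩⟩
    · rw [norm_div, div_eq_inv_mul]
      gcongr
      linarith [norm_nonneg y₂]
    · rw [div_mul_cancel₀ _ h₁, ← norm_inv, ← norm_mul, sub_self, norm_zero, zero_add]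
      refine le_of_eq (congrArg _ ?_)
      field_simp

namespace IsSystemSolution

variable {α β γ u v : ℝ → ℂ} {L : ℝ}

/-- Observability upgrades the decay of `u` to that of `(u, v)`, along translations under which `β`
is asymptotically invariant on one fixed unit window. -/
theorem tendsto_translate (h : IsSystemSolution α β γ L u v) (hβ : ∀ᵐ x, β x ≠ 0)
    (hu : Tendsto u (cocompact ℝ) (𝓝 0)) {s : ℝ} {q : ℕ → ℝ}
    (hq : Tendsto (fun m => |q m|) atTop atTop)
    (hD : Tendsto (fun m => ∫ x in s..s + 1, ‖β (x + q m) - β x‖) atTop (𝓝 0)) :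
    Tendsto (fun m => ‖u (s + q m)‖ + ‖v (s + q m)‖) atTop (𝓝 0) := by
  obtain ⟨κ, hκ, η, hη, hobs⟩ := h.observability hβ s
  rw [Metric.tendsto_nhds]
  intro ε hε
  have h1 : ∀ᶠ x in cocompact ℝ, ‖u x‖ < ε / (2 * κ) := by
    simpa using (Metric.tendsto_nhds.1 hu (ε / (2 * κ)) (by positivity))
  obtain ⟨R, hR⟩ : ∃ R, ∀ x, R < |x| → ‖u x‖ < ε / (2 * κ) := by
    obtain ⟨K, hK, hKs⟩ := mem_cocompact.1 h1
    obtain ⟨R, hR⟩ := hK.isBounded.exists_norm_le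
    refine ⟨R, fun x hx => hKs fun hxK => ?_⟩
    exact absurd (hR x hxK) (not_le.2 hx)
  filter_upwards [hD.eventually_le_const hη, hq.eventually_gt_atTop (R + (|s| + 1))] with m hm₁ hm₂
  have := hobs (q m) (ε / (2 * κ)) hm₁ fun t ht => (hR _ ?_).le
  · rw [Real.dist_0_eq_abs, abs_of_nonneg (by positivity)]
    refine this.trans_lt ?_
    have : κ * (ε / (2 * κ)) = ε / 2 := by field_simp
    linarith
  · have h2 : |t| ≤ |s| + 1 := by
      rw [abs_le]
      constructor <;> linarith [ht.1, ht.2, neg_abs_le s, le_abs_self s]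
    have h3 : |q m| ≤ |t + q m| + |t| := by
      have := abs_sub (t + q m) t
      rwa [add_sub_cancel_left] at this
    linarith

theorem growth_zero (h : IsSystemSolution α β γ L u v) {t r : ℝ} (ht : |t| ≤ r) :
    ‖u t‖ + ‖v t‖ ≤ (‖u 0‖ + ‖v 0‖) * Real.exp (2 * L * r) := by
  refine (h.growth 0 t).trans ?_
  have := h.L_nonneg
  rw [sub_zero]
  gcongr

theorem integral_coeffDist_le (h : IsSystemSolution α β γ L u v) (p : ℝ) {a b c d : ℝ}
    (h1 : c ≤ a) (h2 : a ≤ b) (h3 : b ≤ d) :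
    ∫ x in a..b, coeffDist α β γ p x ≤ ∫ x in c..d, coeffDist α β γ p x :=
  intervalIntegral.integral_mono_interval h1 h2 h3
    (Eventually.of_forall fun x => coeffDist_nonneg p x)
    ((h.locallyIntegrable_coeffDist p).integrableOn_isCompact isCompact_uIcc).intervalIntegrable

/-- The Wronskian of a solution and its translate is almost constant. -/
theorem norm_det_le (h : IsSystemSolution α β γ L u v) {p : ℝ} (hp : 2 ≤ p) :
    ‖u 0 * (v p + v (-p)) - v 0 * (u p + u (-p))‖ ≤
      (‖u 0‖ + ‖v 0‖) ^ 2 * Real.exp (4 * L * p) * ∫ x in -p..p - 2, coeffDist α β γ p x := by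
  have hu := h.prim_u.comp_add_right p
  have hv := h.prim_v.comp_add_right p
  have hw := ((h.prim_u.mul hv).sub (h.prim_v.mul hu)).2 (-p) 0
  simp only [zero_add, neg_add_cancel] at hw
  have e : u 0 * (v p + v (-p)) - v 0 * (u p + u (-p)) =
      u 0 * v p - v 0 * u p - (u (-p) * v 0 - v (-p) * u 0) := by ring
  have hii := fun a b => ((h.locallyIntegrable_coeffDist p).integrableOn_isCompact
      (isCompact_uIcc (a := a) (b := b))).intervalIntegrable
  set M := ‖u 0‖ + ‖v 0‖ with hM
  rw [e, ← hw]
  calc _ ≤ ∫ x in -p..0, (M * Real.exp (2 * L * p)) ^ 2 * coeffDist α β γ p x := by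
        refine intervalIntegral.norm_integral_le_of_norm_le (by linarith)
          (Eventually.of_forall fun x hx => ?_) ((hii _ _).const_mul _)
        have g1 := h.growth_zero (t := x) (r := p) (abs_le.2 ⟨hx.1.le, by linarith [hx.2]⟩)
        have g2 := h.growth_zero (t := x + p) (r := p)
          (abs_le.2 ⟨by linarith [hx.1], by linarith [hx.2]⟩)
        -- Because the trace is zero, the derivative of the Wronskian contains only differences of
        -- coefficients.
        have hid : (α x * u x + β x * v x) * v (x + p) +
              u x * (γ (x + p) * u (x + p) - α (x + p) * v (x + p)) -
            ((γ x * u x - α x * v x) * u (x + p) +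
              v x * (α (x + p) * u (x + p) + β (x + p) * v (x + p))) =
            (γ (x + p) - γ x) * (u x * u (x + p)) -
              ((α (x + p) - α x) * (u x * v (x + p) + v x * u (x + p)) +
                (β (x + p) - β x) * (v x * v (x + p))) := by ring
        rw [hid]
        have hprod : (‖u x‖ + ‖v x‖) * (‖u (x + p)‖ + ‖v (x + p)‖) ≤
            (M * Real.exp (2 * L * p)) ^ 2 := by
          rw [sq]; gcongr
        have n1 : ‖(γ (x + p) - γ x) * (u x * u (x + p))‖ =
            ‖γ (x + p) - γ x‖ * (‖u x‖ * ‖u (x + p)‖) := by rw [norm_mul, norm_mul]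
        have n2 : ‖(α (x + p) - α x) * (u x * v (x + p) + v x * u (x + p))‖ ≤
            ‖α (x + p) - α x‖ * (‖u x‖ * ‖v (x + p)‖ + ‖v x‖ * ‖u (x + p)‖) := by
          rw [norm_mul, ← norm_mul (u x), ← norm_mul (v x)]
          gcongr
          exact norm_add_le _ _
        have n3 : ‖(β (x + p) - β x) * (v x * v (x + p))‖ =
            ‖β (x + p) - β x‖ * (‖v x‖ * ‖v (x + p)‖) := by rw [norm_mul, norm_mul]
        have m1 : ‖u x‖ * ‖u (x + p)‖ ≤ (M * Real.exp (2 * L * p)) ^ 2 := by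
          refine le_trans ?_ hprod; gcongr <;> simp
        have m2 : ‖u x‖ * ‖v (x + p)‖ + ‖v x‖ * ‖u (x + p)‖ ≤ (M * Real.exp (2 * L * p)) ^ 2 := by
          refine le_trans ?_ hprod
          have : 0 ≤ ‖u x‖ * ‖u (x + p)‖ := by positivity
          have : 0 ≤ ‖v x‖ * ‖v (x + p)‖ := by positivity
          linarith
        have m3 : ‖v x‖ * ‖v (x + p)‖ ≤ (M * Real.exp (2 * L * p)) ^ 2 := by
          refine le_trans ?_ hprod; gcongr <;> simp
        calc _ ≤ ‖γ (x + p) - γ x‖ * (‖u x‖ * ‖u (x + p)‖) +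
              (‖α (x + p) - α x‖ * (‖u x‖ * ‖v (x + p)‖ + ‖v x‖ * ‖u (x + p)‖) +
                ‖β (x + p) - β x‖ * (‖v x‖ * ‖v (x + p)‖)) := by
              rw [← n1, ← n3]
              exact (norm_sub_le _ _).trans (by gcongr; exact (norm_add_le _ _).trans (by gcongr))
          _ ≤ ‖γ (x + p) - γ x‖ * (M * Real.exp (2 * L * p)) ^ 2 +
              (‖α (x + p) - α x‖ * (M * Real.exp (2 * L * p)) ^ 2 +
                ‖β (x + p) - β x‖ * (M * Real.exp (2 * L * p)) ^ 2) := by gcongr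
          _ = _ := by unfold coeffDist; ring
    _ = M ^ 2 * Real.exp (4 * L * p) * ∫ x in -p..0, coeffDist α β γ p x := by
        rw [intervalIntegral.integral_const_mul, mul_pow, ← Real.exp_nat_mul]
        congr 3
        push_cast; ring
    _ ≤ _ := by
        gcongr
        exact h.integral_coeffDist_le p le_rfl (by linarith) (by linarith)

/-- If the sum of the translates of a solution by `p` and `-p` is close to a multiple of the
solution at time `0`, it stays close at time `p - 2`. -/
theorem translates_le (h : IsSystemSolution α β γ L u v) {p : ℝ} (hp : 2 ≤ p) (τ : ℂ) :
    ‖u (2 * p - 2) + u (-2) - τ * u (p - 2)‖ + ‖v (2 * p - 2) + v (-2) - τ * v (p - 2)‖ ≤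
      (‖u p + u (-p) - τ * u 0‖ + ‖v p + v (-p) - τ * v 0‖ +
        2 * (‖u 0‖ + ‖v 0‖) * Real.exp (4 * L * p) * ∫ x in -p..p - 2, coeffDist α β γ p x) *
      Real.exp (2 * L * p) := by
  have hL := h.L_nonneg
  set M := ‖u 0‖ + ‖v 0‖ with hM
  have hu₁ := h.prim_u.comp_add_right p
  have hv₁ := h.prim_v.comp_add_right p
  have hu₂ := h.prim_u.comp_add_right (-p)
  have hv₂ := h.prim_v.comp_add_right (-p)
  have hy₁ := (hu₁.add hu₂).sub (h.prim_u.const_mul τ)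
  have hy₂ := (hv₁.add hv₂).sub (h.prim_v.const_mul τ)
  have hc := h.locallyIntegrable_coeffDist p
  have hc' := hc.comp_add_right (-p)
  have hiic := fun a b => (hc.integrableOn_isCompact
      (isCompact_uIcc (a := a) (b := b))).intervalIntegrable
  have hiic' := fun a b => (hc'.integrableOn_isCompact
      (isCompact_uIcc (a := a) (b := b))).intervalIntegrable
  -- The combination solves the original system up to forcing terms that are coefficient differences
  -- times translates of the solution. Those translates stay at times of modulus at most `2 p`,
  -- whence the factor `exp (4 L p)`.
  have key := norm_add_norm_le_of_system (s := 0) (t := p - 2)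
    (y₁ := fun x => u (x + p) + u (x + -p) - τ * u x)
    (y₂ := fun x => v (x + p) + v (x + -p) - τ * v x)
    (e₁ := fun x => (α (x + p) - α x) * u (x + p) + (β (x + p) - β x) * v (x + p) +
      ((α (x + -p) - α x) * u (x + -p) + (β (x + -p) - β x) * v (x + -p)))
    (e₂ := fun x => (γ (x + p) - γ x) * u (x + p) - (α (x + p) - α x) * v (x + p) +
      ((γ (x + -p) - γ x) * u (x + -p) - (α (x + -p) - α x) * v (x + -p)))
    (e := fun x => (M * Real.exp (4 * L * p)) *
      (coeffDist α β γ p x + coeffDist α β γ p (x + -p)))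
    (η := 2 * M * Real.exp (4 * L * p) * ∫ x in -p..p - 2, coeffDist α β γ p x)
    h.bound_α h.bound_β h.bound_γ (by convert! hy₁ using 2; ring) (by convert! hy₂ using 2; ring)
    ((hc.add hc').smul (M * Real.exp (4 * L * p))) ?_ ?_
  · simp only [zero_add] at key
    have a1 : p - 2 + p = 2 * p - 2 := by ring
    have a2 : p - 2 + -p = -2 := by ring
    rw [a1, a2] at key
    refine key.trans ?_
    have : 0 ≤ ∫ x in -p..p - 2, coeffDist α β γ p x :=
      intervalIntegral.integral_nonneg (by linarith) fun x _ => coeffDist_nonneg p x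
    gcongr
    rw [sub_zero, abs_of_nonneg (by linarith)]
    linarith
  · intro x hx
    rw [uIcc_of_le (by linarith)] at hx
    have g1 := h.growth_zero (t := x + p) (r := 2 * p)
      (abs_le.2 ⟨by linarith [hx.1], by linarith [hx.2]⟩)
    have g2 := h.growth_zero (t := x + -p) (r := 2 * p)
      (abs_le.2 ⟨by linarith [hx.1], by linarith [hx.2]⟩)
    rw [show 2 * L * (2 * p) = 4 * L * p by ring, ← hM] at g1 g2
    set G := M * Real.exp (4 * L * p) with hG
    have aux : ∀ A B C U V : ℂ, ‖U‖ + ‖V‖ ≤ G →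
        ‖A * U + B * V‖ + ‖C * U - A * V‖ ≤ G * (‖A‖ + ‖B‖ + ‖C‖) := by
      intro A B C U V hUV
      have i1 : ‖A * U + B * V‖ ≤ ‖A‖ * ‖U‖ + ‖B‖ * ‖V‖ := by
        rw [← norm_mul, ← norm_mul]; exact norm_add_le _ _
      have i2 : ‖C * U - A * V‖ ≤ ‖C‖ * ‖U‖ + ‖A‖ * ‖V‖ := by
        rw [← norm_mul, ← norm_mul]; exact norm_sub_le _ _
      have hu' := norm_nonneg U
      have hv' := norm_nonneg V
      have j1 := mul_le_mul_of_nonneg_left hUV (norm_nonneg A)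
      have j2 : ‖B‖ * ‖V‖ ≤ ‖B‖ * G := by gcongr; linarith
      have j3 : ‖C‖ * ‖U‖ ≤ ‖C‖ * G := by gcongr; linarith
      linarith
    have f1 := aux (α (x + p) - α x) (β (x + p) - β x) (γ (x + p) - γ x) _ _ g1
    have f2 := aux (α (x + -p) - α x) (β (x + -p) - β x) (γ (x + -p) - γ x) _ _ g2
    -- The distance for the shift `-p` at `x` is the distance for `p` at `x - p`. Both error
    -- integrals thus lie over `[-p, p - 2]`, which accounts for the factor 2.
    have c2 : coeffDist α β γ p (x + -p) =
        ‖α (x + -p) - α x‖ + ‖β (x + -p) - β x‖ + ‖γ (x + -p) - γ x‖ := by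
      unfold coeffDist
      rw [neg_add_cancel_right, norm_sub_rev, norm_sub_rev (β x), norm_sub_rev (γ x)]
    rw [c2, mul_add]
    refine le_trans ?_ (add_le_add f1 f2)
    refine (add_le_add (norm_add_le _ _) (norm_add_le _ _)).trans ?_
    linarith
  · rw [intervalIntegral.integral_const_mul, intervalIntegral.integral_add (hiic _ _) (hiic' _ _),
      intervalIntegral.integral_comp_add_right (fun x => coeffDist α β γ p x)]
    have i1 := h.integral_coeffDist_le p (a := 0) (b := p - 2) (c := -p) (d := p - 2)
      (by linarith) (by linarith) le_rfl
    have i2 := h.integral_coeffDist_le p (a := 0 + -p) (b := p - 2 + -p) (c := -p) (d := p - 2)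
      (by linarith) (by linarith) (by linarith)
    have n1 : 0 ≤ ∫ x in (0 : ℝ)..p - 2, coeffDist α β γ p x :=
      intervalIntegral.integral_nonneg (by linarith) fun x _ => coeffDist_nonneg p x
    have n2 : 0 ≤ ∫ x in 0 + -p..p - 2 + -p, coeffDist α β γ p x :=
      intervalIntegral.integral_nonneg (by linarith) fun x _ => coeffDist_nonneg p x
    rw [abs_of_nonneg (by positivity)]
    calc _ ≤ M * Real.exp (4 * L * p) * ((∫ x in -p..p - 2, coeffDist α β γ p x) +
          ∫ x in -p..p - 2, coeffDist α β γ p x) := by gcongr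
      _ = _ := by ring

/-- Gordon's argument: a solution that vanishes at infinity of a system which is, with a
sufficiently large exponential rate, approximately periodic is zero. -/
theorem eq_zero_of_approx_periodic (h : IsSystemSolution α β γ L u v) (hβ : ∀ᵐ x, β x ≠ 0)
    (hu : Tendsto u (cocompact ℝ) (𝓝 0)) {p : ℕ → ℝ} (hp : Tendsto p atTop atTop)
    (hD : Tendsto (fun m => Real.exp ((6 * L + 1) * p m) *
      ∫ x in -p m..p m - 2, coeffDist α β γ (p m) x) atTop (𝓝 0)) : u = 0 := by
  by_contra hne
  have hL := h.L_nonneg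
  have hx : ¬(u 0 = 0 ∧ v 0 = 0) := fun h0 => hne (h.eq_zero h0.1 h0.2)
  obtain ⟨c, hc, hτ⟩ := exists_scalar_of_det_small hx
  choose τ hτ₁ hτ₂ using fun m => hτ (u (p m) + u (-p m)) (v (p m) + v (-p m))
  set M := ‖u 0‖ + ‖v 0‖ with hM
  set D := fun m => ∫ x in -p m..p m - 2, coeffDist α β γ (p m) x with hDdef
  have hp3 : ∀ᶠ m in atTop, 3 ≤ p m := hp.eventually_ge_atTop 3
  have hD0 : ∀ᶠ m in atTop, 0 ≤ D m := hp3.mono fun m hm =>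
    intervalIntegral.integral_nonneg (by linarith) fun x _ => coeffDist_nonneg _ x
  have hDlim : Tendsto D atTop (𝓝 0) := by
    refine squeeze_zero' hD0 ?_ hD
    filter_upwards [hp3, hD0] with m h1 h2
    exact le_mul_of_one_le_left h2 (Real.one_le_exp (by positivity))
  have hcii := fun q a b => ((h.locallyIntegrable_coeffDist q).integrableOn_isCompact
      (isCompact_uIcc (a := a) (b := b))).intervalIntegrable
  have hbii := fun q a b => ((h.locInt_β.norm_translate_sub q).integrableOn_isCompact
      (isCompact_uIcc (a := a) (b := b))).intervalIntegrable
  have hβD : ∀ m a, -p m ≤ a → a + 1 ≤ p m - 2 →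
      ∫ x in a..a + 1, ‖β (x + p m) - β x‖ ≤ D m := by
    intro m a h1 h2
    refine le_trans (intervalIntegral.integral_mono (by linarith) (hbii _ _ _) (hcii (p m) _ _)
      fun x => ?_) (h.integral_coeffDist_le (p m) h1 (by linarith) h2)
    unfold coeffDist
    linarith [norm_nonneg (α (x + p m) - α x), norm_nonneg (γ (x + p m) - γ x)]
  have habs : Tendsto (fun m => |p m|) atTop atTop := tendsto_abs_atTop_atTop.comp hp
  -- decay at the four relevant times
  have t1 : Tendsto (fun m => ‖u (0 + p m)‖ + ‖v (0 + p m)‖) atTop (𝓝 0) := by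
    refine h.tendsto_translate hβ hu habs (squeeze_zero' (Eventually.of_forall fun m =>
      intervalIntegral.integral_nonneg (by linarith) fun _ _ => norm_nonneg _) ?_ hDlim)
    filter_upwards [hp3] with m hm using hβD m 0 (by linarith) (by linarith)
  have t2 : Tendsto (fun m => ‖u (0 + -p m)‖ + ‖v (0 + -p m)‖) atTop (𝓝 0) := by
    refine h.tendsto_translate hβ hu (by simpa using habs)
      (squeeze_zero' (Eventually.of_forall fun m =>
      intervalIntegral.integral_nonneg (by linarith) fun _ _ => norm_nonneg _) ?_ hDlim)
    filter_upwards [hp3] with m hm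
    have := hβD m (-p m) le_rfl (by linarith)
    -- Comparing `β` with its translate by `-p` on `[0, 1]` is comparing it with its translate by
    -- `p` on `[-p, 1 - p]`.
    have e := intervalIntegral.integral_comp_add_right (a := 0) (b := 0 + 1)
      (fun x => ‖β (x + p m) - β x‖) (-p m)
    simp only [neg_add_cancel_right, zero_add] at e
    rw [zero_add]
    calc _ = ∫ x in (0 : ℝ)..1, ‖β x - β (x + -p m)‖ := by
          congr 1; ext x; exact norm_sub_rev _ _
      _ ≤ _ := by rw [e, add_comm 1]; exact this
  have t3 : Tendsto (fun m => ‖u (-2 + p m)‖ + ‖v (-2 + p m)‖) atTop (𝓝 0) := by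
    refine h.tendsto_translate hβ hu habs (squeeze_zero' (Eventually.of_forall fun m =>
      intervalIntegral.integral_nonneg (by linarith) fun _ _ => norm_nonneg _) ?_ hDlim)
    filter_upwards [hp3] with m hm using hβD m (-2) (by linarith) (by linarith)
  -- A shift by `2 p` is controlled by two shifts by `p`, on `[-3, -2]` and on `[p - 3, p - 2]`. The
  -- start `-3` is the latest for which the second window stays within the controlled range; one
  -- unit of growth then leads to `2 p - 2`.
  have t4 : Tendsto (fun m => ‖u (-3 + 2 * p m)‖ + ‖v (-3 + 2 * p m)‖) atTop (𝓝 0) := by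
    refine h.tendsto_translate hβ hu ?_ (squeeze_zero' (g := fun m => D m + D m)
      (Eventually.of_forall fun m =>
      intervalIntegral.integral_nonneg (by linarith) fun _ _ => norm_nonneg _) ?_ ?_)
    · simpa [abs_mul] using habs.const_mul_atTop (by norm_num : (0 : ℝ) < 2)
    · filter_upwards [hp3] with m hm
      have i1 := hβD m (-3) (by linarith) (by linarith)
      have i2 := hβD m (-3 + p m) (by linarith) (by linarith)
      have e := intervalIntegral.integral_comp_add_right (a := -3) (b := -3 + 1)
        (fun x => ‖β (x + p m) - β x‖) (p m)
      rw [show -3 + p m + 1 = -3 + 1 + p m by ring, ← e] at i2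
      refine le_trans ?_ (add_le_add i2 i1)
      have hshift := ((h.locInt_β.norm_translate_sub (p m)).comp_add_right (p m))
      rw [← intervalIntegral.integral_add
        (hshift.integrableOn_isCompact isCompact_uIcc).intervalIntegrable (hbii _ _ _)]
      refine intervalIntegral.integral_mono (by norm_num) (hbii _ _ _)
        ((hshift.integrableOn_isCompact isCompact_uIcc).intervalIntegrable.add (hbii _ _ _))
        fun x => ?_
      beta_reduce
      rw [show x + 2 * p m = x + p m + p m by ring]
      exact norm_sub_le_norm_sub_add_norm_sub _ _ _
    · simpa using hDlim.add hDlim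
  have t4' : Tendsto (fun m => ‖u (2 * p m - 2)‖ + ‖v (2 * p m - 2)‖) atTop (𝓝 0) := by
    have := t4.mul_const (Real.exp (2 * L))
    rw [zero_mul] at this
    refine squeeze_zero (fun m => by positivity) (fun m => ?_) this
    refine (h.growth (-3 + 2 * p m) _).trans (le_of_eq ?_)
    rw [show 2 * p m - 2 - (-3 + 2 * p m) = 1 by ring, abs_one, mul_one]
  have hτ0 : Tendsto (fun m => ‖τ m‖) atTop (𝓝 0) := by
    have := (t1.add t2).const_mul c
    simp only [zero_add, add_zero, mul_zero] at this
    refine squeeze_zero (fun m => norm_nonneg _) (fun m => (hτ₁ m).trans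
      (mul_le_mul_of_nonneg_left ?_ hc)) this
    linarith [norm_add_le (u (p m)) (u (-p m)), norm_add_le (v (p m)) (v (-p m))]
  have hZ : Tendsto (fun m => ‖u (2 * p m - 2) + u (-2) - τ m * u (p m - 2)‖ +
      ‖v (2 * p m - 2) + v (-2) - τ m * v (p m - 2)‖) atTop (𝓝 0) := by
    -- The rate needed is `4 L` from the Wronskian and forcing bounds plus `2 L` from propagation to
    -- time `p - 2`; the remaining `1` is slack.
    have := hD.const_mul (c * M ^ 2 + 2 * M)
    rw [mul_zero] at this
    refine squeeze_zero' (Eventually.of_forall fun m => by positivity) ?_ this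
    filter_upwards [hp3, hD0] with m hm hDm
    have h1 := h.translates_le (p := p m) (by linarith) (τ m)
    have h2 := h.norm_det_le (p := p m) (by linarith)
    rw [← hM] at h1 h2
    change _ ≤ _ * D m at h2
    have h3 := (hτ₂ m).trans (mul_le_mul_of_nonneg_left h2 hc)
    calc _ ≤ _ := h1
      _ ≤ (c * (M ^ 2 * Real.exp (4 * L * p m) * D m) +
          2 * M * Real.exp (4 * L * p m) * D m) * Real.exp (2 * L * p m) := by gcongr
      _ = (c * M ^ 2 + 2 * M) * (Real.exp (4 * L * p m + 2 * L * p m) * D m) := by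
          rw [Real.exp_add]; ring
      _ ≤ _ := by
          gcongr
          linarith
  have hfin := (hZ.add t4').add (hτ0.mul t3)
  simp only [add_zero, mul_zero] at hfin
  have hle : ‖u (-2)‖ + ‖v (-2)‖ ≤ 0 := by
    refine ge_of_tendsto' hfin fun m => ?_
    rw [show -2 + p m = p m - 2 by ring]
    have tri : ∀ a b s w : ℂ, ‖b‖ ≤ ‖a + b - s * w‖ + ‖a‖ + ‖s‖ * ‖w‖ := by
      intro a b s w
      rw [← norm_mul]
      calc ‖b‖ = ‖(a + b - s * w) - a + s * w‖ := by congr 1; ring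
        _ ≤ _ := (norm_add_le _ _).trans (by gcongr; exact norm_sub_le _ _)
    have a1 := tri (u (2 * p m - 2)) (u (-2)) (τ m) (u (p m - 2))
    have a2 := tri (v (2 * p m - 2)) (v (-2)) (τ m) (v (p m - 2))
    linarith
  have n1 := norm_nonneg (u (-2))
  have n2 := norm_nonneg (v (-2))
  exact hne (h.eq_zero (s := -2) (norm_le_zero_iff.1 (by linarith))
    (norm_le_zero_iff.1 (by linarith)))

end IsSystemSolution

/-! ### Complex measures: finite variation and Fubini -/

instance MeasureTheory.ComplexMeasure.isFiniteMeasure_variation {X : Type*} [MeasurableSpace X]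
    (c : ComplexMeasure X) : IsFiniteMeasure c.variation := by
  have h : c.variation ≤ (ComplexMeasure.re c).totalVariation +
      (ComplexMeasure.im c).totalVariation := by
    refine VectorMeasure.variation_le_of_forall_enorm_le fun s _ => ?_
    have h1 := SignedMeasure.enorm_le_totalVariation (ComplexMeasure.re c) s
    have h2 := SignedMeasure.enorm_le_totalVariation (ComplexMeasure.im c) s
    refine le_trans ?_ (add_le_add h1 h2)
    change ‖c s‖ₑ ≤ ‖(c s).re‖ₑ + ‖(c s).im‖ₑ
    rw [← ofReal_norm, ← ofReal_norm, ← ofReal_norm,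
      ← ENNReal.ofReal_add (norm_nonneg _) (norm_nonneg _)]
    exact ENNReal.ofReal_le_ofReal (Complex.norm_le_abs_re_add_abs_im _)
  exact isFiniteMeasure_of_le _ h

/-- Fubini's theorem for a complex measure and a measure with density. -/
theorem MeasureTheory.ComplexMeasure.integral_withDensity_fiber (c : ComplexMeasure ℝ) {g : ℝ → ℂ}
    (hg : Integrable g) {S : Set (ℝ × ℝ)} (hS : MeasurableSet S) :
    VectorMeasure.integral c (fun x => ∫ t in Prod.mk x ⁻¹' S, g t) (ContinuousLinearMap.mul ℝ ℂ) =
      ∫ t, g t * c ((fun x => (x, t)) ⁻¹' S) := by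
  have hmeas : ∀ T : Set (ℝ × ℝ), MeasurableSet T →
      AEStronglyMeasurable (fun t => g t * c ((fun x => (x, t)) ⁻¹' T)) volume := fun T hT => by
    refine hg.1.mul ?_
    exact (VectorMeasure.stronglyMeasurable_vectorMeasure_prodMk_left (ν := c)
      (measurable_swap hT)).aestronglyMeasurable
  have hint : ∀ T : Set (ℝ × ℝ), MeasurableSet T →
      Integrable (fun t => g t * c ((fun x => (x, t)) ⁻¹' T)) := fun T hT => by
    refine (hg.norm.mul_const (c.bound : ℝ)).mono' (hmeas T hT) (Eventually.of_forall fun t => ?_)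
    rw [norm_mul]
    gcongr
    exact VectorMeasure.norm_apply_le_bound
  have key : (VectorMeasure.prod c (volume.withDensityᵥ g) (ContinuousLinearMap.mul ℝ ℂ).flip) S =
      ∫ t, g t * c ((fun x => (x, t)) ⁻¹' S) := by
    -- Rectangles generate, and both sides are countably additive in the set; on the right this is
    -- dominated convergence with majorant `‖g‖ * c.bound`.
    induction S, hS using MeasurableSpace.induction_on_inter generateFrom_prod.symm
      isPiSystem_prod with
    | empty => simp
    | basic T hT =>
      obtain ⟨A, hA, B, hB, rfl⟩ := hT
      have hB' : MeasurableSet B := hB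
      rw [VectorMeasure.prod_apply, withDensityᵥ_apply hg hB', ← integral_indicator hB']
      simp only [ContinuousLinearMap.flip_apply, ContinuousLinearMap.mul_apply']
      rw [← integral_mul_const]
      congr 1
      ext t
      by_cases ht : t ∈ B
      · simp [ht]
      · simp [ht]
    | compl T hT ih =>
      rw [VectorMeasure.of_compl hT, ih, ← univ_prod_univ, VectorMeasure.prod_apply,
        withDensityᵥ_apply hg MeasurableSet.univ, Measure.restrict_univ]
      simp only [ContinuousLinearMap.flip_apply, ContinuousLinearMap.mul_apply']
      rw [← integral_mul_const, ← integral_sub (hg.mul_const _) (hint T hT)]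
      congr 1
      ext t
      rw [preimage_compl, VectorMeasure.of_compl (measurable_prodMk_right hT)]
      ring
    | iUnion f hd hf ih =>
      have h1 := VectorMeasure.hasSum_of_disjoint_iUnion
        (v := VectorMeasure.prod c (volume.withDensityᵥ g) (ContinuousLinearMap.mul ℝ ℂ).flip) hf hd
      refine h1.unique ?_
      simp_rw [ih]
      simp only [HasSum, SummationFilter.unconditional_filter]
      simp_rw [← integral_finsetSum _ fun i _ => hint (f i) (hf i)]
      refine tendsto_integral_filter_of_dominated_convergence (fun t => ‖g t‖ * c.bound) ?_ ?_
        (hg.norm.mul_const _) ?_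
      · exact Eventually.of_forall fun s =>
          Finset.aestronglyMeasurable_fun_sum _ fun i _ => hmeas _ (hf i)
      · refine Eventually.of_forall fun s => Eventually.of_forall fun t => ?_
        rw [← Finset.mul_sum, ← VectorMeasure.of_biUnion_finset
          (fun i _ j _ hij => (hd hij).preimage _) (fun i _ => measurable_prodMk_right (hf i)),
          norm_mul]
        gcongr
        exact VectorMeasure.norm_apply_le_bound
      · refine Eventually.of_forall fun t => ?_
        simp_rw [← Finset.mul_sum]
        refine Tendsto.const_mul _ ?_
        rw [preimage_iUnion]
        exact VectorMeasure.hasSum_of_disjoint_iUnion (v := c)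
          (fun i => measurable_prodMk_right (hf i)) (fun i j hij => (hd hij).preimage _)
  rw [← key, VectorMeasure.prod_flip_apply_eq_integral hS]
  congr 1
  ext x
  rw [withDensityᵥ_apply hg (measurable_prodMk_left hS)]

/-! ### Distribution function and the decomposition of a local measure -/

namespace LocalMeasure

theorem restr_apply (μ : LocalMeasure) {K A : Set ℝ} (hK : MeasurableSet K)
    (hb : Bornology.IsBounded K) (hA : MeasurableSet A) : μ.restr K A = μ.toFun (A ∩ K) :=
  if_pos ⟨hA, hK, hb⟩

theorem toFun_Ioc_add (μ : LocalMeasure) {r s t : ℝ} (hrs : r ≤ s) (hst : s ≤ t) :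
    μ.toFun (Ioc r s) + μ.toFun (Ioc s t) = μ.toFun (Ioc r t) := by
  have hb : Bornology.IsBounded (Ioc r t) := Metric.isBounded_Ioc r t
  have h := VectorMeasure.of_union (v := μ.restr (Ioc r t)) (Ioc_disjoint_Ioc_of_le (le_refl s) :
    Disjoint (Ioc r s) (Ioc s t)) measurableSet_Ioc measurableSet_Ioc
  rw [Ioc_union_Ioc_eq_Ioc hrs hst, μ.restr_apply measurableSet_Ioc hb measurableSet_Ioc,
    μ.restr_apply measurableSet_Ioc hb measurableSet_Ioc,
    μ.restr_apply measurableSet_Ioc hb measurableSet_Ioc, inter_self,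
    inter_eq_left.2 (Ioc_subset_Ioc_right hst), inter_eq_left.2 (Ioc_subset_Ioc_left hrs)] at h
  exact h.symm

/-- The distribution function `t ↦ μ ((0, t])` of a local measure, with a sign for `t < 0`. -/
noncomputable def cdf (μ : LocalMeasure) (t : ℝ) : ℂ :=
  if 0 ≤ t then μ.toFun (Ioc 0 t) else -μ.toFun (Ioc t 0)

theorem cdf_sub (μ : LocalMeasure) {s t : ℝ} (hst : s ≤ t) :
    μ.cdf t - μ.cdf s = μ.toFun (Ioc s t) := by
  unfold cdf
  rcases le_total 0 s with hs | hs
  · rw [if_pos hs, if_pos (hs.trans hst), ← μ.toFun_Ioc_add hs hst]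
    ring
  · have hs' : (if 0 ≤ s then μ.toFun (Ioc 0 s) else -μ.toFun (Ioc s 0)) = -μ.toFun (Ioc s 0) := by
      split_ifs with h
      · rw [le_antisymm hs h, Ioc_self, μ.empty', neg_zero]
      · rfl
    rw [hs']
    rcases le_total 0 t with ht | ht
    · rw [if_pos ht, ← μ.toFun_Ioc_add hs ht]
      ring
    · have ht' : (if 0 ≤ t then μ.toFun (Ioc 0 t) else -μ.toFun (Ioc t 0)) =
          -μ.toFun (Ioc t 0) := by
        split_ifs with h
        · rw [le_antisymm ht h, Ioc_self, μ.empty', neg_zero]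
        · rfl
      rw [ht', ← μ.toFun_Ioc_add hst ht]
      ring

/-- On a bounded interval the distribution function comes from a single finite complex measure,
which supplies its measurability and boundedness there. -/
theorem cdf_eq_on (μ : LocalMeasure) (R : ℝ) {t : ℝ} (ht : t ∈ Icc (-R) R) :
    μ.cdf t = μ.cdf R - μ.restr (Ioc (-R) R) (Ioi t) := by
  rw [μ.restr_apply measurableSet_Ioc (Metric.isBounded_Ioc _ _) measurableSet_Ioi]
  have : Ioi t ∩ Ioc (-R) R = Ioc t R := by
    ext x
    simp only [mem_inter_iff, mem_Ioi, mem_Ioc]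
    exact ⟨fun h => ⟨h.1, h.2.2⟩, fun h => ⟨h.1, ht.1.trans_lt h.1, h.2⟩⟩
  rw [this, ← μ.cdf_sub ht.2]
  ring

theorem _root_.MeasureTheory.ComplexMeasure.stronglyMeasurable_Ioi (c : ComplexMeasure ℝ) :
    StronglyMeasurable fun t => c (Ioi t) := by
  have hS : MeasurableSet {q : ℝ × ℝ | q.1 < q.2} := measurableSet_lt measurable_fst measurable_snd
  exact VectorMeasure.stronglyMeasurable_vectorMeasure_prodMk_left (ν := c) hS

theorem locallyIntegrable_cdf (μ : LocalMeasure) : LocallyIntegrable μ.cdf := by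
  rw [locallyIntegrable_iff]
  intro k hk
  obtain ⟨R, hR⟩ := hk.isBounded.exists_norm_le
  have hsub : k ⊆ Icc (-R) R := fun x hx => abs_le.1 (hR x hx)
  refine IntegrableOn.mono_set ?_ hsub
  refine IntegrableOn.congr_fun (f := fun t => μ.cdf R - μ.restr (Ioc (-R) R) (Ioi t)) ?_
    (fun t ht => (μ.cdf_eq_on R ht).symm) measurableSet_Icc
  refine Measure.integrableOn_of_bounded (M := ‖μ.cdf R‖ + (μ.restr (Ioc (-R) R)).bound)
    (by simp) ?_ ?_
  · exact (aestronglyMeasurable_const.sub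
      (ComplexMeasure.stronglyMeasurable_Ioi _).aestronglyMeasurable)
  · refine Eventually.of_forall fun t => (norm_sub_le _ _).trans ?_
    gcongr
    exact VectorMeasure.norm_apply_le_bound

theorem restr_eq_restrict (μ : LocalMeasure) {J K : Set ℝ} (hJ : MeasurableSet J)
    (hK : MeasurableSet K) (hb : Bornology.IsBounded K) (hJK : J ⊆ K) :
    μ.restr J = (μ.restr K).restrict J := by
  ext A hA
  rw [VectorMeasure.restrict_apply _ hJ hA, μ.restr_apply hJ (hb.subset hJK) hA,
    μ.restr_apply hK hb (hA.inter hJ), inter_eq_left.2 (inter_subset_right.trans hJK)]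

theorem integral_eq_integral_restr (μ : LocalMeasure) {φ : ℝ → ℂ} {K : Set ℝ}
    (hK : MeasurableSet K) (hb : Bornology.IsBounded K) (hφ : tsupport φ ⊆ K) :
    μ.integral φ = (μ.restr K).integral φ (ContinuousLinearMap.mul ℝ ℂ) := by
  have hm : MeasurableSet (tsupport φ) := (isClosed_tsupport φ).measurableSet
  unfold LocalMeasure.integral
  rw [μ.restr_eq_restrict hm hK hb hφ, ← VectorMeasure.integral_indicator hm,
    indicator_eq_self.2 (subset_tsupport φ)]

/-- Integration by parts: `∫ φ dμ = -∫ F φ'`, where `F` is the distribution function of `μ`. -/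
theorem integral_eq_neg_integral_cdf (μ : LocalMeasure) {φ g : ℝ → ℂ} (h : IsPrimitive φ g)
    {R : ℝ} (hφ : ∀ x, R < |x| → φ x = 0) (hg : ∀ x, R < |x| → g x = 0) :
    Integrable (fun t => μ.cdf t * g t) ∧ μ.integral φ = -∫ t, μ.cdf t * g t := by
  set r := |R| + 1 with hr
  have hRr : R < r := by linarith [le_abs_self R]
  have hr0 : 0 < r := by positivity
  have hout : ∀ x, x ∉ Ioo (-r) r → R < |x| := fun x hx => by
    by_contra hxR
    exact hx ⟨by linarith [neg_abs_le x], by linarith [le_abs_self x]⟩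
  have hgi : Integrable g := by
    rw [← integrableOn_iff_integrable_of_support_subset (s := Icc (-r) r)]
    · exact h.1.integrableOn_isCompact isCompact_Icc
    · intro x hx
      by_contra hxK
      exact hx (hg x (hout x fun hx' => hxK ⟨hx'.1.le, hx'.2.le⟩))
  have hφI : ∀ x, ∫ t in Iio x, g t = φ x := by
    intro x
    have hpre : ∀ y, y ≤ x → y ≤ -r → ∫ t in Iio x, g t = φ x := by
      intro y hyx hy
      have hy' : ∀ z ≤ y, R < |z| := fun z hz => hout z fun hz' => by linarith [hz'.1]
      rw [← integral_Iic_eq_integral_Iio, ← sub_zero (φ x), ← hφ y (hy' y le_rfl), ← h.2 y x,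
        ← intervalIntegral.integral_Iic_sub_Iic hgi.integrableOn hgi.integrableOn]
      rw [setIntegral_eq_zero_of_forall_eq_zero (t := Iic y) fun z hz => hg z (hy' z hz), sub_zero]
    exact hpre (min x (-r)) (min_le_left _ _) (min_le_right _ _)
  have hts : tsupport φ ⊆ Ioc (-r) r := by
    refine (closure_minimal (t := Icc (-|R|) |R|) (fun x hx => ?_) isClosed_Icc).trans
      fun x hx => ⟨by linarith [hx.1], by linarith [hx.2]⟩
    refine abs_le.1 (le_of_not_gt fun hxR => hx (hφ x ((le_abs_self R).trans_lt hxR)))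
  have hF := ComplexMeasure.integral_withDensity_fiber (μ.restr (Ioc (-r) r)) hgi
    (S := {q : ℝ × ℝ | q.2 < q.1}) (measurableSet_lt measurable_snd measurable_fst)
  have e1 : ∀ x : ℝ, Prod.mk x ⁻¹' {q : ℝ × ℝ | q.2 < q.1} = Iio x := fun x => rfl
  have e2 : ∀ t : ℝ, (fun x => (x, t)) ⁻¹' {q : ℝ × ℝ | q.2 < q.1} = Ioi t := fun t => rfl
  simp only [e1, e2, hφI] at hF
  have hmi : Integrable fun t => g t * μ.restr (Ioc (-r) r) (Ioi t) := by
    refine (hgi.norm.mul_const ((μ.restr (Ioc (-r) r)).bound : ℝ)).mono' (hgi.1.mul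
      (ComplexMeasure.stronglyMeasurable_Ioi _).aestronglyMeasurable)
      (Eventually.of_forall fun t => ?_)
    rw [norm_mul]
    gcongr
    exact VectorMeasure.norm_apply_le_bound
  -- Fubini produces the tails `μ ((t, r])`; the constant `μ.cdf r` by which they differ from
  -- `-μ.cdf t` is harmless because `g` has integral zero.
  have hcdf : (fun t => μ.cdf t * g t) =
      fun t => μ.cdf r * g t - g t * μ.restr (Ioc (-r) r) (Ioi t) := by
    ext t
    by_cases ht : t ∈ Ioo (-r) r
    · rw [μ.cdf_eq_on r ⟨ht.1.le, ht.2.le⟩]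
      ring
    · rw [hg t (hout t ht)]
      ring
  have h0 : ∫ t, g t = 0 :=
    h.integral_eq_zero (a := -r) (b := r) (by linarith) (hφ _ (hout _ (by simp)))
      (hφ _ (hout _ (by simp))) fun x hx => by
        by_cases hx' : x ∈ Ioo (-r) r
        · exact absurd ⟨hx'.1, hx'.2.le⟩ hx
        · exact hg x (hout x hx')
  rw [hcdf]
  refine ⟨(hgi.const_mul _).sub hmi, ?_⟩
  rw [μ.integral_eq_integral_restr measurableSet_Ioc (Metric.isBounded_Ioc _ _) hts, hF,
    integral_sub (hgi.const_mul _) hmi, integral_const_mul, h0]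
  ring

/-- The density `ρ t = μ ((t, t + 1])` of the absolutely continuous part of the decomposition
`μ = N' + ρ` of a local measure. -/
noncomputable def dens (μ : LocalMeasure) (t : ℝ) : ℂ := μ.cdf (t + 1) - μ.cdf t

/-- The function `N` in the decomposition `μ = N' + ρ` of a local measure: the difference of the
distribution function and its running mean. -/
noncomputable def reg (μ : LocalMeasure) (t : ℝ) : ℂ := μ.cdf t - ∫ x in t..t + 1, μ.cdf x

theorem locallyIntegrable_dens (μ : LocalMeasure) : LocallyIntegrable μ.dens :=
  (μ.locallyIntegrable_cdf.comp_add_right 1).sub μ.locallyIntegrable_cdf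

/-- This is the reason for `μ = N' + ρ`: subtracting from the distribution function its running
mean, whose derivative is `ρ`, removes exactly `ρ` from `μ`. -/
theorem isPrimitive_mean (μ : LocalMeasure) :
    IsPrimitive (fun t => ∫ x in t..t + 1, μ.cdf x) μ.dens := by
  have h := isPrimitive_intervalIntegral μ.locallyIntegrable_cdf 0 0
  convert! (h.comp_add_right 1).sub h using 2 with t
  have hi := μ.locallyIntegrable_cdf.intervalIntegrable'
  rw [zero_add, zero_add, intervalIntegral.integral_interval_sub_left (hi _ _) (hi _ _)]

theorem locallyIntegrable_reg (μ : LocalMeasure) : LocallyIntegrable μ.reg :=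
  μ.locallyIntegrable_cdf.sub μ.isPrimitive_mean.continuous.locallyIntegrable

theorem norm_toFun_Ioc_le (μ : LocalMeasure) (hμ : μ.unifNorm < ⊤) {s t : ℝ} (hts : t ≤ s + 1) :
    ‖μ.toFun (Ioc s t)‖ ≤ μ.unifNorm.toReal := by
  have h1 : μ.toFun (Ioc s t) = μ.restr (Ioc s (s + 1)) (Ioc s t) := by
    rw [μ.restr_apply measurableSet_Ioc (Metric.isBounded_Ioc _ _) measurableSet_Ioc,
      inter_eq_left.2 (Ioc_subset_Ioc_right hts)]
  rw [h1, ← toReal_enorm]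
  refine ENNReal.toReal_mono hμ.ne ?_
  refine (VectorMeasure.enorm_measure_le_variation _ _).trans ((measure_mono (subset_univ _)).trans ?_)
  exact le_iSup (fun x : ℝ => μ.totalVariation (Ioc x (x + 1))) s

theorem norm_dens_le (μ : LocalMeasure) (hμ : μ.unifNorm < ⊤) (t : ℝ) :
    ‖μ.dens t‖ ≤ μ.unifNorm.toReal := by
  unfold dens
  rw [μ.cdf_sub (by linarith)]
  exact μ.norm_toFun_Ioc_le hμ le_rfl

/-- `N(t)` is an average of `-μ ((t, x])` over `x` in `(t, t + 1]`, so only intervals of length at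
most one occur. -/
theorem norm_reg_le (μ : LocalMeasure) (hμ : μ.unifNorm < ⊤) (t : ℝ) :
    ‖μ.reg t‖ ≤ μ.unifNorm.toReal := by
  have h1 : μ.reg t = ∫ x in t..t + 1, (μ.cdf t - μ.cdf x) := by
    rw [intervalIntegral.integral_sub intervalIntegrable_const
      (μ.locallyIntegrable_cdf.intervalIntegrable' _ _)]
    simp [reg]
  rw [h1]
  refine (intervalIntegral.norm_integral_le_of_norm_le_const (C := μ.unifNorm.toReal)
    fun x hx => ?_).trans (by simp)
  rw [uIoc_of_le (by linarith)] at hx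
  rw [norm_sub_rev, μ.cdf_sub hx.1.le]
  exact μ.norm_toFun_Ioc_le hμ hx.2

theorem _root_.MeasureTheory.LocallyIntegrable.integrable_of_eq_zero {f : ℝ → ℂ}
    (hf : LocallyIntegrable f) {R : ℝ} (h : ∀ x, R < |x| → f x = 0) : Integrable f := by
  rw [← integrableOn_iff_integrable_of_support_subset (s := Icc (-R) R)]
  · exact hf.integrableOn_isCompact isCompact_Icc
  · exact fun x hx => abs_le.1 (le_of_not_gt fun hxR => hx (h x hxR))

theorem _root_.IsPrimitive.integral_eq_zero_of_abs {f g : ℝ → ℂ} (h : IsPrimitive f g) {R : ℝ}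
    (hf : ∀ x, R < |x| → f x = 0) (hg : ∀ x, R < |x| → g x = 0) : ∫ x, g x = 0 := by
  have hR : R < |R| + 1 := by linarith [le_abs_self R]
  have hR' : R < |(|R| + 1)| := by rwa [abs_of_pos (by positivity)]
  refine h.integral_eq_zero (a := -(|R| + 1)) (b := |R| + 1)
    (by linarith [abs_nonneg R]) (hf _ (by rwa [abs_neg])) (hf _ hR') fun x hx => hg x ?_
  by_contra hxR
  exact hx ⟨by linarith [neg_abs_le x], by linarith [le_abs_self x]⟩

/-- The decomposition `μ = N' + ρ` in the sense of distributions. -/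
theorem integral_eq_reg_dens (μ : LocalMeasure) {φ g : ℝ → ℂ} (h : IsPrimitive φ g)
    {R : ℝ} (hφ : ∀ x, R < |x| → φ x = 0) (hg : ∀ x, R < |x| → g x = 0)
    (hreg : LocallyIntegrable fun t => μ.reg t * g t) :
    μ.integral φ = -(∫ t, μ.reg t * g t) + ∫ t, μ.dens t * φ t := by
  have hcdf := μ.integral_eq_neg_integral_cdf h hφ hg
  have hprod := μ.isPrimitive_mean.mul h
  have h0 := hprod.integral_eq_zero_of_abs (R := R) (fun x hx => by rw [hφ x hx, mul_zero])
    (fun x hx => by rw [hφ x hx, hg x hx, mul_zero, mul_zero, add_zero])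
  have hi1 : Integrable fun t => μ.dens t * φ t :=
    (μ.locallyIntegrable_dens.mul_continuous h.continuous).integrable_of_eq_zero (R := R)
      fun x hx => by rw [hφ x hx, mul_zero]
  have hi2 : Integrable fun t => (∫ x in t..t + 1, μ.cdf x) * g t :=
    (h.1.continuous_mul μ.isPrimitive_mean.continuous).integrable_of_eq_zero (R := R)
      fun x hx => by rw [hg x hx, mul_zero]
  have hi3 : Integrable fun t => μ.reg t * g t :=
    hreg.integrable_of_eq_zero (R := R) fun x hx => by rw [hg x hx, mul_zero]
  rw [integral_add hi1 hi2] at h0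
  have e : (fun t => μ.cdf t * g t) =
      fun t => μ.reg t * g t + (∫ x in t..t + 1, μ.cdf x) * g t := by
    ext t; unfold reg; ring
  rw [hcdf.2, e, integral_add hi3 hi2]
  linear_combination -h0

/-- The constant comes from normalising at `0`. It cancels in `dens` and in `reg`, so the
decomposition commutes with translations. -/
theorem cdf_translate (μ : LocalMeasure) (p t : ℝ) :
    (μ.translate p).cdf t = μ.cdf (t + p) - μ.cdf p := by
  have e : ∀ a b : ℝ, (μ.translate p).toFun (Ioc a b) = μ.toFun (Ioc (a + p) (b + p)) := by
    intro a b
    change μ.toFun ((fun x => x - p) ⁻¹' Ioc a b) = _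
    rw [preimage_sub_const_Ioc]
  rcases le_total 0 t with ht | ht
  · rw [μ.cdf_sub (by linarith), cdf, if_pos ht, e, zero_add]
  · have h1 := (μ.translate p).cdf_sub ht
    have h2 : (μ.translate p).cdf 0 = 0 := by
      rw [cdf, if_pos le_rfl, Ioc_self, (μ.translate p).empty']
    rw [h2, e, zero_add, ← μ.cdf_sub (by linarith)] at h1
    linear_combination -h1

theorem cdf_sub_translate (μ : LocalMeasure) (p t : ℝ) :
    (μ - μ.translate p).cdf t = μ.cdf t - μ.cdf (t + p) + μ.cdf p := by
  have h : (μ - μ.translate p).cdf t = μ.cdf t - (μ.translate p).cdf t := by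
    have e : ∀ A, (μ - μ.translate p).toFun A = μ.toFun A - (μ.translate p).toFun A := fun _ => rfl
    unfold cdf
    split_ifs
    · exact e _
    · rw [e]; ring
  rw [h, cdf_translate]
  ring

theorem dens_sub_translate (μ : LocalMeasure) (p t : ℝ) :
    (μ - μ.translate p).dens t = μ.dens t - μ.dens (t + p) := by
  unfold dens
  rw [cdf_sub_translate, cdf_sub_translate, add_right_comm]
  ring

theorem reg_sub_translate (μ : LocalMeasure) (p t : ℝ) :
    (μ - μ.translate p).reg t = μ.reg t - μ.reg (t + p) := by
  unfold reg
  have hi := μ.locallyIntegrable_cdf.intervalIntegrable'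
  have hi' := (μ.locallyIntegrable_cdf.comp_add_right p).intervalIntegrable'
  simp_rw [cdf_sub_translate]
  rw [intervalIntegral.integral_add ((hi _ _).sub (hi' _ _)) intervalIntegrable_const,
    intervalIntegral.integral_sub (hi _ _) (hi' _ _),
    intervalIntegral.integral_comp_add_right (fun x => μ.cdf x), add_right_comm t 1 p]
  simp
  ring

/-! ### From the weak norm to `L¹` bounds -/

theorem norm_integral_le_weakNorm (μ : LocalMeasure) {I : Set ℝ} (hI : μ.weakNorm I ≠ ⊤)
    {φ g : ℝ → ℂ} (h : IsPrimitive φ g) {x : ℝ} (hxI : Icc x (x + 2) ⊆ I) (hg : ∀ t, ‖g t‖ ≤ 2)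
    (hφ0 : ∀ t, t ∉ Icc x (x + 2) → φ t = 0) (hg0 : ∀ t, t ∉ Icc x (x + 2) → g t = 0) :
    ‖μ.integral φ‖ ≤ 2 * (μ.weakNorm I).toReal := by
  have hR : ∀ t, |x| + 2 < |t| → t ∉ Icc x (x + 2) := by
    intro t ht hmem
    have : |t| ≤ |x| + 2 := abs_le.2
      ⟨by linarith [hmem.1, neg_abs_le x], by linarith [hmem.2, le_abs_self x]⟩
    linarith
  have h' := h.const_mul (1 / 2)
  -- Halving makes `φ` 1-Lipschitz. Homogeneity is read off from integration by parts.
  have hhalf : μ.integral φ = 2 * μ.integral fun t => 1 / 2 * φ t := by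
    rw [(μ.integral_eq_neg_integral_cdf h (fun t ht => hφ0 t (hR t ht))
        (fun t ht => hg0 t (hR t ht))).2,
      (μ.integral_eq_neg_integral_cdf h' (fun t ht => by rw [hφ0 t (hR t ht), mul_zero])
        (fun t ht => by rw [hg0 t (hR t ht), mul_zero])).2]
    simp_rw [mul_left_comm _ (1 / 2 : ℂ)]
    rw [integral_const_mul]
    ring
  have hts : tsupport (fun t => 1 / 2 * φ t) ⊆ Icc x (x + 2) := by
    refine closure_minimal (fun t ht => ?_) isClosed_Icc
    by_contra htm
    exact ht (by simp [hφ0 t htm])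
  have hlip : LipschitzWith 1 fun t => 1 / 2 * φ t := by
    refine LipschitzWith.of_dist_le_mul fun s t => ?_
    rw [dist_eq_norm, ← h'.2 t s, NNReal.coe_one, one_mul, Real.dist_eq, ← one_mul |s - t|]
    refine intervalIntegral.norm_integral_le_of_norm_le_const fun r _ => ?_
    rw [norm_mul]
    have := hg r
    norm_num
    linarith
  have hdiam : Metric.ediam (tsupport fun t => 1 / 2 * φ t) ≤ 2 := by
    refine (Metric.ediam_mono hts).trans ?_
    rw [Real.ediam_Icc]
    simp
  have hle : ‖μ.integral fun t => 1 / 2 * φ t‖ₑ ≤ μ.weakNorm I :=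
    le_iSup_of_le (fun t => 1 / 2 * φ t) (le_iSup_of_le hlip (le_iSup_of_le (hts.trans hxI)
      (le_iSup_of_le hdiam le_rfl)))
  rw [hhalf, norm_mul, Complex.norm_two, ← toReal_enorm (μ.integral _)]
  gcongr

end LocalMeasure

theorem MeasureTheory.LocallyIntegrable.integrable_mul_of_bounded {f ψ : ℝ → ℂ}
    (hf : LocallyIntegrable f) (hψ : AEStronglyMeasurable ψ volume) {C a b : ℝ}
    (hC : ∀ t, ‖ψ t‖ ≤ C) (h0 : ∀ t, t ∉ Ioc a b → ψ t = 0) : Integrable fun t => f t * ψ t := by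
  rw [← integrableOn_iff_integrable_of_support_subset (s := Icc a b)]
  · exact (hf.integrableOn_isCompact isCompact_Icc).mul_bdd (c := C) hψ.restrict
      (Eventually.of_forall fun t => hC t)
  · intro t ht
    by_contra htab
    exact ht (by simp [h0 t fun h => htab ⟨h.1.le, h.2⟩])

theorem MeasureTheory.LocallyIntegrable.mul_bounded {f ψ : ℝ → ℂ}
    (hf : LocallyIntegrable f) (hψ : AEStronglyMeasurable ψ volume) {C : ℝ}
    (hC : ∀ t, ‖ψ t‖ ≤ C) : LocallyIntegrable fun t => f t * ψ t := fun x => by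
  obtain ⟨U, hU, hi⟩ := hf x
  exact ⟨U, hU, hi.mul_bdd (c := C) hψ.restrict (Eventually.of_forall fun t => hC t)⟩

theorem MeasureTheory.locallyIntegrable_of_norm_le {ψ : ℝ → ℂ}
    (hψ : AEStronglyMeasurable ψ volume) {C : ℝ} (hC : ∀ t, ‖ψ t‖ ≤ C) : LocallyIntegrable ψ := by
  have h1 : LocallyIntegrable fun _ : ℝ => (1 : ℂ) := locallyIntegrable_const _
  simpa using h1.mul_bounded hψ hC

/-- The `L¹` norm over an interval is attained at a bounded function with support there. -/
theorem exists_dual_function {f : ℝ → ℂ} (hf : AEStronglyMeasurable f volume) (x : ℝ) :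
    ∃ ψ : ℝ → ℂ, AEStronglyMeasurable ψ volume ∧ (∀ t, ‖ψ t‖ ≤ 1) ∧
      (∀ t, t ∉ Ioc x (x + 1) → ψ t = 0) ∧
      ∫ t, f t * ψ t = ((∫ t in x..x + 1, ‖f t‖ : ℝ) : ℂ) := by
  refine ⟨(Ioc x (x + 1)).indicator fun t => (starRingEnd ℂ) (f t) / ‖f t‖, ?_, ?_, ?_, ?_⟩
  · refine AEStronglyMeasurable.indicator ?_ measurableSet_Ioc
    exact ((Complex.continuous_conj.comp_aestronglyMeasurable hf).aemeasurable.div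
      (Complex.continuous_ofReal.comp_aestronglyMeasurable hf.norm).aemeasurable).aestronglyMeasurable
  · intro t
    refine (norm_indicator_le_norm_self _ _).trans ?_
    rw [norm_div, RCLike.norm_conj, Complex.norm_real, norm_norm]
    exact div_self_le_one _
  · exact fun t ht => indicator_of_notMem ht _
  · rw [intervalIntegral.integral_of_le (by linarith), ← integral_indicator measurableSet_Ioc,
      ← integral_complex_ofReal]
    congr 1
    ext t
    by_cases ht : t ∈ Ioc x (x + 1)
    · rw [indicator_of_mem ht, indicator_of_mem ht, mul_div_assoc', Complex.mul_conj,
        Complex.normSq_eq_norm_sq]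
      by_cases h0 : ‖f t‖ = 0
      · simp [h0]
      · rw [Complex.ofReal_pow, sq, mul_div_cancel_right₀]
        exact_mod_cast h0
    · simp [ht]

namespace LocalMeasure

/-- Summation by parts: the forward difference is minus the adjoint of the backward difference. -/
theorem integral_mul_sub_translate {f ψ : ℝ → ℂ} (hf : LocallyIntegrable f)
    (hψ : AEStronglyMeasurable ψ volume) {C a b : ℝ} (hC : ∀ t, ‖ψ t‖ ≤ C)
    (h0 : ∀ t, t ∉ Ioc a b → ψ t = 0) :
    ∫ t, f t * (ψ t - ψ (t + -1)) = -∫ t, (f (t + 1) - f t) * ψ t := by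
  have i1 := hf.integrable_mul_of_bounded hψ hC h0
  have i2 := (hf.comp_add_right 1).integrable_mul_of_bounded hψ hC h0
  have i3 : Integrable fun t => f t * ψ (t + -1) := by
    have := i2.comp_add_right (-1)
    simpa using this
  have e := integral_add_right_eq_self (μ := volume) (fun t => f (t + 1) * ψ t) (-1)
  simp only [neg_add_cancel_right] at e
  simp_rw [mul_sub, sub_mul]
  rw [integral_sub i1 i3, integral_sub i2 i1, e]
  ring

/-- Each pairing with `ψ` equals the integral against `μ` of a 2-Lipschitz function supported in
`[x, x + 2]`. The primitive `Θ` of `ψ` need not have compact support, but it is constant off `[x, x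
+ 1]`, so its unit differences vanish off `[x, x + 2]`. -/
theorem norm_integral_dens_reg_le (μ : LocalMeasure) {I : Set ℝ} (hI : μ.weakNorm I ≠ ⊤) {x : ℝ}
    (hxI : Icc x (x + 2) ⊆ I) {ψ : ℝ → ℂ} (hψ : AEStronglyMeasurable ψ volume)
    (h1 : ∀ t, ‖ψ t‖ ≤ 1) (h0 : ∀ t, t ∉ Ioc x (x + 1) → ψ t = 0) :
    ‖∫ t, μ.dens t * ψ t‖ ≤ 2 * (μ.weakNorm I).toReal ∧
      ‖∫ t, μ.reg t * ψ t‖ ≤ 2 * (μ.weakNorm I).toReal := by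
  have hψl := locallyIntegrable_of_norm_le hψ h1
  have hΘ : IsPrimitive (fun t => ∫ r in x..t, ψ r) ψ := by
    simpa using isPrimitive_intervalIntegral hψl 0 x
  set Θ := fun t => ∫ r in x..t, ψ r with hΘdef
  have hΔ := hΘ.sub (hΘ.comp_add_right (-1))
  have hleft : ∀ t ≤ x, Θ t = 0 := fun t ht => by
    refine (intervalIntegral.integral_congr_ae (g := fun _ => 0)
      (Eventually.of_forall fun r hr => h0 r fun hr' => ?_)).trans (by simp)
    rw [uIoc_of_ge ht] at hr
    exact absurd hr'.1 (not_lt.2 hr.2)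
  have hright : ∀ t, x + 1 ≤ t → Θ t = Θ (x + 1) := fun t ht => by
    rw [← sub_eq_zero, ← hΘ.2]
    refine (intervalIntegral.integral_congr_ae (g := fun _ => 0)
      (Eventually.of_forall fun r hr => h0 r fun hr' => ?_)).trans (by simp)
    rw [uIoc_of_le ht] at hr
    exact absurd hr'.2 (not_le.2 hr.1)
  have hΔ0 : ∀ t, t ∉ Icc x (x + 2) → Θ t - Θ (t + -1) = 0 := by
    intro t ht
    by_cases htx : t < x
    · rw [hleft t htx.le, hleft _ (by linarith), sub_zero]
    · have : x + 2 < t := by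
        by_contra h
        exact ht ⟨not_lt.1 htx, not_lt.1 h⟩
      rw [hright t (by linarith), hright (t + -1) (by linarith), sub_self]
  have hψ0 : ∀ t, t ∉ Icc x (x + 2) → ψ t - ψ (t + -1) = 0 := by
    intro t ht
    rw [h0 t fun h => ht ⟨h.1.le, by linarith [h.2]⟩,
      h0 (t + -1) fun h => ht ⟨by linarith [h.1], by linarith [h.2]⟩, sub_zero]
  have hΔ1 : ∀ t, ‖Θ t - Θ (t + -1)‖ ≤ 1 := by
    intro t
    rw [← hΘ.2]
    refine (intervalIntegral.norm_integral_le_of_norm_le_const fun r _ => h1 r).trans ?_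
    simp
  have hR : ∀ t, |x| + 2 < |t| → t ∉ Icc x (x + 2) := by
    intro t ht hmem
    have : |t| ≤ |x| + 2 := abs_le.2
      ⟨by linarith [hmem.1, neg_abs_le x], by linarith [hmem.2, le_abs_self x]⟩
    linarith
  constructor
  · have hint := μ.integral_eq_neg_integral_cdf hΔ (fun t ht => hΔ0 t (hR t ht))
      (fun t ht => hψ0 t (hR t ht))
    rw [integral_mul_sub_translate μ.locallyIntegrable_cdf hψ h1 h0, neg_neg] at hint
    change ‖∫ t, (μ.cdf (t + 1) - μ.cdf t) * ψ t‖ ≤ _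
    rw [← hint.2]
    refine μ.norm_integral_le_weakNorm hI hΔ hxI (fun t => ?_) hΔ0 hψ0
    linarith [norm_sub_le (ψ t) (ψ (t + -1)), h1 t, h1 (t + -1)]
  · have hQ : IsPrimitive (fun t => ∫ r in x..t, Θ r) Θ := by
      simpa using isPrimitive_intervalIntegral hΘ.continuous.locallyIntegrable 0 x
    set Q := fun t => ∫ r in x..t, Θ r with hQdef
    -- For `N` the test function is the mean of `Θ` over `[t - 1, t]` minus `Θ t`; it vanishes
    -- wherever `Θ` is constant on `[t - 1, t]`.
    have hφ := (hQ.sub (hQ.comp_add_right (-1))).sub hΘ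
    have hφ0 : ∀ t, t ∉ Icc x (x + 2) → Q t - Q (t + -1) - Θ t = 0 := by
      intro t ht
      rw [← hQ.2]
      by_cases htx : t < x
      · rw [hleft t htx.le, sub_zero]
        refine (intervalIntegral.integral_congr (g := fun _ => 0) fun r hr => ?_).trans (by simp)
        rw [uIcc_of_le (by linarith)] at hr
        exact hleft r (by linarith [hr.2])
      · have : x + 2 < t := by
          by_contra h
          exact ht ⟨not_lt.1 htx, not_lt.1 h⟩
        rw [hright t (by linarith)]
        refine sub_eq_zero.2 ((intervalIntegral.integral_congr (g := fun _ => Θ (x + 1))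
          fun r hr => ?_).trans (by simp))
        rw [uIcc_of_le (by linarith)] at hr
        exact hright r (by linarith [hr.1])
    have hg0 : ∀ t, t ∉ Icc x (x + 2) → Θ t - Θ (t + -1) - ψ t = 0 := by
      intro t ht
      rw [hΔ0 t ht, h0 t fun h => ht ⟨h.1.le, by linarith [h.2]⟩, sub_zero]
    have hint := μ.integral_eq_neg_integral_cdf hφ (fun t ht => hφ0 t (hR t ht))
      (fun t ht => hg0 t (hR t ht))
    have hP : IsPrimitive (fun t => ∫ r in (0 : ℝ)..t, μ.cdf r) μ.cdf := by
      simpa using isPrimitive_intervalIntegral μ.locallyIntegrable_cdf 0 0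
    set P := fun t => ∫ r in (0 : ℝ)..t, μ.cdf r with hPdef
    -- Moving the derivative from the primitive `P` of the distribution function to the difference
    -- of `Θ` yields the pairing of the running mean with `ψ`.
    have hprod := (hP.mul hΔ).integral_eq_zero_of_abs (R := |x| + 2)
      (fun t ht => by rw [hΔ0 t (hR t ht), mul_zero])
      (fun t ht => by rw [hΔ0 t (hR t ht), hψ0 t (hR t ht), mul_zero, mul_zero, add_zero])
    have j1 : Integrable fun t => μ.cdf t * (Θ t - Θ (t + -1)) :=
      (μ.locallyIntegrable_cdf.mul_continuous hΔ.continuous).integrable_of_eq_zero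
        (R := |x| + 2) fun t ht => by rw [hΔ0 t (hR t ht), mul_zero]
    have j2 : Integrable fun t => P t * (ψ t - ψ (t + -1)) :=
      (hΔ.1.continuous_mul hP.continuous).integrable_of_eq_zero
        (R := |x| + 2) fun t ht => by rw [hψ0 t (hR t ht), mul_zero]
    have j3 := μ.locallyIntegrable_cdf.integrable_mul_of_bounded hψ h1 h0
    have j4 := μ.isPrimitive_mean.continuous.locallyIntegrable.integrable_mul_of_bounded hψ h1 h0
    rw [integral_add j1 j2, integral_mul_sub_translate hP.continuous.locallyIntegrable hψ h1 h0]
      at hprod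
    simp_rw [hP.2 _ _ |>.symm] at hprod
    have e : ∫ t, μ.reg t * ψ t = μ.integral fun t => Q t - Q (t + -1) - Θ t := by
      rw [hint.2]
      simp_rw [mul_sub _ (Θ _ - Θ _)]
      rw [integral_sub j1 j3]
      unfold reg
      simp_rw [sub_mul]
      rw [integral_sub j3 j4]
      linear_combination hprod
    rw [e]
    refine μ.norm_integral_le_weakNorm hI hφ hxI (fun t => ?_) hφ0 hg0
    linarith [norm_sub_le (Θ t - Θ (t + -1)) (ψ t), h1 t, hΔ1 t]

theorem integral_norm_dens_reg_le (μ : LocalMeasure) {I : Set ℝ} (hI : μ.weakNorm I ≠ ⊤) {x : ℝ}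
    (hxI : Icc x (x + 2) ⊆ I) :
    ∫ t in x..x + 1, ‖μ.dens t‖ ≤ 2 * (μ.weakNorm I).toReal ∧
      ∫ t in x..x + 1, ‖μ.reg t‖ ≤ 2 * (μ.weakNorm I).toReal := by
  constructor
  · obtain ⟨ψ, hm, h1, h0, he⟩ := exists_dual_function μ.locallyIntegrable_dens.aestronglyMeasurable x
    have := (μ.norm_integral_dens_reg_le hI hxI hm h1 h0).1
    rw [he, Complex.norm_real] at this
    exact (le_abs_self _).trans this
  · obtain ⟨ψ, hm, h1, h0, he⟩ := exists_dual_function μ.locallyIntegrable_reg.aestronglyMeasurable x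
    have := (μ.norm_integral_dens_reg_le hI hxI hm h1 h0).2
    rw [he, Complex.norm_real] at this
    exact (le_abs_self _).trans this

theorem integral_norm_dens_reg_long_le (μ : LocalMeasure) {p : ℝ} (hp : 2 ≤ p)
    (hI : μ.weakNorm (Icc (-p) p) ≠ ⊤) :
    ∫ t in -p..p - 2, (‖μ.dens t‖ + ‖μ.reg t‖) ≤
      8 * p * (μ.weakNorm (Icc (-p) p)).toReal := by
  set w := (μ.weakNorm (Icc (-p) p)).toReal with hw
  have hii : ∀ a b, IntervalIntegrable (fun t => ‖μ.dens t‖ + ‖μ.reg t‖) volume a b := fun a b =>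
    (μ.locallyIntegrable_dens.intervalIntegrable' a b).norm.add
      (μ.locallyIntegrable_reg.intervalIntegrable' a b).norm
  have hstep : ∀ n : ℕ, -p + n + 1 ≤ p →
      ∫ t in -p..-p + n, (‖μ.dens t‖ + ‖μ.reg t‖) ≤ 4 * n * w := by
    intro n
    induction n with
    | zero => intro _; simp
    | succ n ih =>
      intro hn
      push_cast at hn ⊢
      have h1 := ih (by linarith)
      have h2 := μ.integral_norm_dens_reg_le hI (x := -p + n)
        (Icc_subset_Icc (by linarith [Nat.cast_nonneg (α := ℝ) n]) (by linarith))
      rw [← add_assoc, ← intervalIntegral.integral_add_adjacent_intervals (hii _ (-p + n)) (hii _ _)]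
      have h3 : ∫ t in -p + n..-p + n + 1, (‖μ.dens t‖ + ‖μ.reg t‖) ≤ 4 * w := by
        rw [intervalIntegral.integral_add (μ.locallyIntegrable_dens.intervalIntegrable' _ _).norm
          (μ.locallyIntegrable_reg.intervalIntegrable' _ _).norm]
        linarith [h2.1, h2.2]
      linarith
  -- `⌊2 p - 1⌋` unit steps from `-p` end beyond `p - 2`, while every window of length 2 remains
  -- inside `[-p, p]`. Each step costs `4 w`, and there are at most `2 p` of them.
  have hfl := Nat.floor_le (a := 2 * p - 1) (by linarith)
  have hfl' := Nat.lt_floor_add_one (2 * p - 1)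
  refine (intervalIntegral.integral_mono_interval le_rfl (by linarith)
    (by linarith : p - 2 ≤ -p + (⌊2 * p - 1⌋₊ : ℝ))
    (Eventually.of_forall fun t => by positivity) (hii _ _)).trans ((hstep _ (by linarith)).trans ?_)
  have hw0 : 0 ≤ w := ENNReal.toReal_nonneg
  exact mul_le_mul_of_nonneg_right (by linarith) hw0

end LocalMeasure

/-! ### Test functions and weak derivatives -/

namespace IsTestFunction

variable {φ : ℝ → ℂ}

theorem continuous_deriv (h : IsTestFunction φ) : Continuous (deriv φ) :=
  h.1.continuous_deriv (by simp)

theorem isPrimitive (h : IsTestFunction φ) : IsPrimitive φ (deriv φ) :=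
  ⟨h.continuous_deriv.locallyIntegrable, fun s t => intervalIntegral.integral_deriv_eq_sub
    (fun x _ => (h.1.differentiable (by simp)).differentiableAt)
    (h.continuous_deriv.intervalIntegrable _ _)⟩

theorem exists_eq_zero (h : IsTestFunction φ) :
    ∃ R : ℝ, 0 ≤ R ∧ ∀ x, R < |x| → φ x = 0 ∧ deriv φ x = 0 := by
  obtain ⟨R, hR⟩ := h.2.isCompact.isBounded.exists_norm_le
  refine ⟨max R 0, le_max_right _ _, fun x hx => ?_⟩
  have hx' : x ∉ tsupport φ := fun hm =>
    absurd (hR x hm) (not_le.2 ((le_max_left _ _).trans_lt hx))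
  exact ⟨image_eq_zero_of_notMem_tsupport hx',
    image_eq_zero_of_notMem_tsupport fun hm => hx' (tsupport_deriv_subset hm)⟩

theorem integrable_mul {f : ℝ → ℂ} (h : IsTestFunction φ) (hf : LocallyIntegrable f) :
    Integrable fun x => f x * φ x := by
  obtain ⟨R, -, hR⟩ := h.exists_eq_zero
  exact (hf.mul_continuous h.1.continuous).integrable_of_eq_zero (R := R) fun x hx => by
    rw [(hR x hx).1, mul_zero]

theorem integrable_mul_deriv {f : ℝ → ℂ} (h : IsTestFunction φ) (hf : LocallyIntegrable f) :
    Integrable fun x => f x * deriv φ x := by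
  obtain ⟨R, -, hR⟩ := h.exists_eq_zero
  exact (hf.mul_continuous h.continuous_deriv).integrable_of_eq_zero (R := R) fun x hx => by
    rw [(hR x hx).2, mul_zero]

/-- A test function with integral zero is the derivative of a test function. -/
theorem exists_deriv_eq (h : IsTestFunction φ) (h0 : ∫ x, φ x = 0) :
    ∃ Φ : ℝ → ℂ, IsTestFunction Φ ∧ deriv Φ = φ := by
  obtain ⟨R, hR0, hR⟩ := h.exists_eq_zero
  set r := R + 1 with hr
  have hrR : ∀ x, r ≤ |x| → φ x = 0 := fun x hx => (hR x (by linarith)).1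
  have hd : ∀ x, HasDerivAt (fun x => ∫ t in -r..x, φ t) (φ x) x := fun x =>
    (h.1.continuous.integral_hasStrictDerivAt _ x).hasDerivAt
  have hderiv : deriv (fun x => ∫ t in -r..x, φ t) = φ := funext fun x => (hd x).deriv
  refine ⟨fun x => ∫ t in -r..x, φ t, ⟨?_, ?_⟩, hderiv⟩
  · rw [contDiff_infty_iff_deriv, hderiv]
    exact ⟨fun x => (hd x).differentiableAt, h.1⟩
  · refine HasCompactSupport.intro (isCompact_Icc (a := -r) (b := r)) fun x hx => ?_
    by_cases hxr : x < -r
    · refine (intervalIntegral.integral_congr_ae (g := fun _ => 0)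
        (Eventually.of_forall fun t ht => hrR t ?_)).trans (by simp)
      rw [uIoc_of_ge hxr.le] at ht
      linarith [neg_le_abs t, ht.2]
    · have hxr' : r < x := by
        by_contra hn
        exact hx ⟨not_lt.1 hxr, not_lt.1 hn⟩
      rw [intervalIntegral.integral_of_le (by linarith), ← h0]
      refine setIntegral_eq_integral_of_forall_compl_eq_zero fun t ht => hrR t ?_
      by_contra hn
      obtain ⟨h1, h2⟩ := abs_lt.1 (not_le.1 hn)
      exact ht ⟨h1, by linarith⟩

end IsTestFunction

theorem exists_isTestFunction_integral_eq_one : ∃ φ : ℝ → ℂ, IsTestFunction φ ∧ ∫ x, φ x = 1 := by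
  let b : ContDiffBump (0 : ℝ) := default
  refine ⟨fun x => (b.normed volume x : ℂ), ⟨?_, ?_⟩, ?_⟩
  · exact Complex.ofRealCLM.contDiff.comp b.contDiff_normed
  · exact (b.hasCompactSupport_normed (μ := volume)).comp_left Complex.ofReal_zero
  · rw [integral_complex_ofReal, b.integral_normed, Complex.ofReal_one]

/-- A locally integrable function with vanishing weak derivative is constant. -/
theorem exists_ae_eq_const {f : ℝ → ℂ} (hf : LocallyIntegrable f)
    (h : ∀ φ, IsTestFunction φ → ∫ x, f x * deriv φ x = 0) : ∃ c : ℂ, ∀ᵐ x, f x = c := by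
  obtain ⟨φ₀, hφ₀, h1⟩ := exists_isTestFunction_integral_eq_one
  refine ⟨∫ x, f x * φ₀ x, ?_⟩
  refine ae_eq_of_integral_contDiff_smul_eq hf (locallyIntegrable_const _) fun g hg hgc => ?_
  have hφ : IsTestFunction fun x => (g x : ℂ) :=
    ⟨Complex.ofRealCLM.contDiff.comp hg, hgc.comp_left Complex.ofReal_zero⟩
  set c := ∫ x, (g x : ℂ) with hc
  have hi0 : Integrable φ₀ := hφ₀.1.continuous.integrable_of_hasCompactSupport hφ₀.2
  have hi : Integrable fun x => (g x : ℂ) := hφ.1.continuous.integrable_of_hasCompactSupport hφ.2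
  -- Subtracting a multiple of the normalised bump makes the integral zero, so the result is the
  -- derivative of a test function (du Bois-Reymond).
  have hψ : IsTestFunction fun x => (g x : ℂ) - c * φ₀ x :=
    ⟨hφ.1.sub (contDiff_const.mul hφ₀.1), hφ.2.sub hφ₀.2.mul_left⟩
  obtain ⟨Φ, hΦ, hΦd⟩ := hψ.exists_deriv_eq (by
    rw [integral_sub hi (hi0.const_mul c), integral_const_mul, h1, mul_one, sub_self])
  have h2 := h Φ hΦ
  rw [hΦd] at h2
  simp_rw [mul_sub, mul_left_comm _ c] at h2
  rw [integral_sub (hφ.integrable_mul hf) ((hφ₀.integrable_mul hf).const_mul c),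
    integral_const_mul] at h2
  simp_rw [Complex.real_smul]
  rw [integral_mul_const]
  simp_rw [mul_comm _ (f _)]
  linear_combination h2

theorem exists_isPrimitive_of_weakDeriv {f g : ℝ → ℂ} (hf : LocallyIntegrable f)
    (hg : LocallyIntegrable g)
    (h : ∀ φ, IsTestFunction φ → ∫ x, f x * deriv φ x = -∫ x, g x * φ x) :
    ∃ F : ℝ → ℂ, IsPrimitive F g ∧ f =ᵐ[volume] F := by
  have hG : IsPrimitive (fun t => ∫ x in (0 : ℝ)..t, g x) g := by
    simpa using isPrimitive_intervalIntegral hg 0 0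
  set G := fun t => ∫ x in (0 : ℝ)..t, g x with hGdef
  obtain ⟨c, hc⟩ := exists_ae_eq_const (f := fun x => f x - G x)
    (hf.sub hG.continuous.locallyIntegrable) fun φ hφ => by
      obtain ⟨R, -, hR⟩ := hφ.exists_eq_zero
      have h0 := (hG.mul hφ.isPrimitive).integral_eq_zero_of_abs (R := R)
        (fun x hx => by rw [(hR x hx).1, mul_zero])
        (fun x hx => by rw [(hR x hx).1, (hR x hx).2, mul_zero, mul_zero, add_zero])
      rw [integral_add (hφ.integrable_mul hg)
        (hφ.integrable_mul_deriv hG.continuous.locallyIntegrable)] at h0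
      simp_rw [sub_mul]
      rw [integral_sub (hφ.integrable_mul_deriv hf)
        (hφ.integrable_mul_deriv hG.continuous.locallyIntegrable), h φ hφ]
      linear_combination -h0
  refine ⟨fun t => c + G t, isPrimitive_intervalIntegral hg c 0, ?_⟩
  filter_upwards [hc] with x hx
  rw [← hx]
  ring

/-! ### Reduction of the eigenvalue equation to the planar system -/

/-- An essentially bounded function agrees almost everywhere with a bounded one. -/
theorem MeasureTheory.MemLp.exists_bounded_ae_eq {f : ℝ → ℂ} (hf : MemLp f ⊤ volume) :
    ∃ (b : ℝ → ℂ) (B : ℝ), AEStronglyMeasurable b volume ∧ (∀ x, ‖b x‖ ≤ B) ∧ b =ᵐ[volume] f := by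
  have hfin : eLpNormEssSup f volume ≠ ⊤ := by
    rw [← eLpNorm_exponent_top]
    exact hf.eLpNorm_lt_top.ne
  set B := (eLpNormEssSup f volume).toReal with hB
  have hae : (fun x => if ‖f x‖ ≤ B then f x else 0) =ᵐ[volume] f := by
    filter_upwards [ae_le_eLpNormEssSup (f := f) (μ := volume)] with x hx
    have h1 : ‖f x‖ ≤ B := by
      rw [← toReal_enorm]
      exact ENNReal.toReal_mono hfin hx
    rw [if_pos h1]
  refine ⟨_, B, hf.aestronglyMeasurable.congr hae.symm, fun x => ?_, hae⟩
  split_ifs with h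
  · exact h
  · rw [norm_zero]
    exact ENNReal.toReal_nonneg

theorem IsWeakDeriv.isPrimitive {u g : ℝ → ℂ} (h : IsWeakDeriv u g) (hu : Continuous u) :
    IsPrimitive u g := by
  obtain ⟨F, hF, hae⟩ := exists_isPrimitive_of_weakDeriv h.1 h.2.1 h.2.2
  rwa [(hu.ae_eq_iff_eq volume hF.continuous).1 hae]

/-- An element of the kernel of `H_{a,μ} - z` solves a planar system whose coefficients depend only
on `b = 1 / a`, on the bounded functions `μ.reg`, `μ.dens` and on `z`. -/
theorem exists_isSystemSolution {a b : ℝ → ℂ} {μ : LocalMeasure} {B : ℝ}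
    (ha : MemLp a ⊤ volume) (hb : AEStronglyMeasurable b volume) (hbB : ∀ x, ‖b x‖ ≤ B)
    (hba : ∀ᵐ x, b x * a x = 1) (hμ : μ.unifNorm < ⊤) {z : ℂ} {u : C₀(ℝ, ℂ)}
    (hu : (u, z • u) ∈ sturmLiouville a μ) :
    ∃ L v, IsSystemSolution (fun x => b x * μ.reg x) b
      (fun x => μ.dens x - z - b x * μ.reg x * μ.reg x) L u v := by
  obtain ⟨g, hug, heq⟩ := hu
  dsimp only at hug heq
  have hprim := hug.isPrimitive u.continuous
  have hg := hug.2.1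
  have hN := μ.locallyIntegrable_reg
  have hD := μ.locallyIntegrable_dens
  have hNK := μ.norm_reg_le hμ
  have hDK := μ.norm_dens_le hμ
  set K := μ.unifNorm.toReal with hK
  have hK0 : 0 ≤ K := ENNReal.toReal_nonneg
  have hB0 : 0 ≤ B := (norm_nonneg _).trans (hbB 0)
  have hNm := hN.aestronglyMeasurable
  have hDm := hD.aestronglyMeasurable
  obtain ⟨a', A, ham, haA, haa⟩ := ha.exists_bounded_ae_eq
  have hag : LocallyIntegrable fun x => g x * a' x := hg.mul_bounded ham haA
  have hNg : LocallyIntegrable fun x => μ.reg x * g x := by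
    simpa only [mul_comm] using hg.mul_bounded hNm hNK
  have hNu : LocallyIntegrable fun x => μ.reg x * u x := hN.mul_continuous u.continuous
  have hDu : LocallyIntegrable fun x => (μ.dens x - z) * u x :=
    (hD.sub (locallyIntegrable_const z)).mul_continuous u.continuous
  -- The quasi-derivative `v = a u' - N u` has weak derivative `(ρ - z) u - N u'`: the singular part
  -- `N' u` of `u μ` cancels against the derivative of `N u`.
  obtain ⟨v, hv, hv_ae⟩ := exists_isPrimitive_of_weakDeriv (hag.sub hNu) (hDu.sub hNg)
    fun φ hφ => by
      obtain ⟨R, -, hR⟩ := hφ.exists_eq_zero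
      have hgφ : LocallyIntegrable fun t => μ.reg t * (g t * φ t + u t * deriv φ t) := by
        have h1 := (hNg.mul_continuous hφ.1.continuous).add
          (hNu.mul_continuous hφ.continuous_deriv)
        refine h1.congr (Eventually.of_forall fun t => ?_)
        simp only [Pi.add_apply]
        ring
      have h1 := μ.integral_eq_reg_dens (hprim.mul hφ.isPrimitive) (R := R)
        (fun x hx => by rw [(hR x hx).1, mul_zero])
        (fun x hx => by rw [(hR x hx).1, (hR x hx).2, mul_zero, mul_zero, add_zero]) hgφ
      have h2 := heq φ hφ
      rw [h1] at h2
      have e1 : ∫ x, a x * g x * deriv φ x = ∫ x, g x * a' x * deriv φ x :=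
        integral_congr_ae (by filter_upwards [haa] with x hx; rw [hx, mul_comm (a x)])
      have e2 : ∫ t, μ.reg t * (g t * φ t + u t * deriv φ t) =
          (∫ t, μ.reg t * g t * φ t) + ∫ t, μ.reg t * u t * deriv φ t := by
        rw [← integral_add (hφ.integrable_mul hNg) (hφ.integrable_mul_deriv hNu)]
        refine integral_congr_ae (Eventually.of_forall fun t => ?_)
        dsimp only
        ring
      have e3 : ∫ x, (μ.dens x - z) * u x * φ x =
          (∫ t, μ.dens t * (u t * φ t)) - ∫ x, (z • u : C₀(ℝ, ℂ)) x * φ x := by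
        rw [← integral_sub]
        · refine integral_congr_ae (Eventually.of_forall fun t => ?_)
          simp only [ZeroAtInftyContinuousMap.coe_smul, Pi.smul_apply, smul_eq_mul]
          ring
        · refine (hφ.integrable_mul (hD.mul_continuous u.continuous)).congr
            (Eventually.of_forall fun t => mul_assoc _ _ _)
        · exact hφ.integrable_mul (z • u : C₀(ℝ, ℂ)).continuous.locallyIntegrable
      simp only [Pi.sub_apply, sub_mul _ _ (φ _), sub_mul _ _ (deriv φ _)]
      rw [integral_sub (hφ.integrable_mul_deriv hag) (hφ.integrable_mul_deriv hNu),
        integral_sub (hφ.integrable_mul hDu) (hφ.integrable_mul hNg), e3]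
      rw [e1, e2] at h2
      linear_combination h2
  have hg_ae : ∀ᵐ x, g x = b x * (v x + μ.reg x * u x) := by
    filter_upwards [hv_ae, hba, haa] with x h1 h2 h3
    rw [← h1, Pi.sub_apply, h3]
    linear_combination (-g x) * h2
  have hbN : ∀ x, ‖b x * μ.reg x‖ ≤ B * K := fun x => by
    rw [norm_mul]
    exact mul_le_mul (hbB x) (hNK x) (norm_nonneg _) hB0
  have hbNN : ∀ x, ‖b x * μ.reg x * μ.reg x‖ ≤ B * K * K := fun x => by
    rw [norm_mul]
    exact mul_le_mul (hbN x) (hNK x) (norm_nonneg _) (by positivity)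
  have hz := norm_nonneg z
  have hBK : 0 ≤ B * K := by positivity
  have hBKK : 0 ≤ B * K * K := by positivity
  have hlα := locallyIntegrable_of_norm_le (hb.mul hNm) hbN
  refine ⟨B + B * K + (K + ‖z‖ + B * K * K), v, hlα, locallyIntegrable_of_norm_le hb hbB,
    (hD.sub (locallyIntegrable_const z)).sub
      (locallyIntegrable_of_norm_le ((hb.mul hNm).mul hNm) hbNN),
    fun x => by linarith [hbN x], fun x => by linarith [hbB x], fun x => ?_,
    hprim.congr_ae ?_, hv.congr_ae ?_⟩
  · have h1 := norm_sub_le (μ.dens x - z) (b x * μ.reg x * μ.reg x)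
    have h2 := norm_sub_le (μ.dens x) z
    linarith [hbNN x, hDK x]
  · filter_upwards [hg_ae] with x hx
    rw [hx]
    ring
  · filter_upwards [hg_ae] with x hx
    simp only [Pi.sub_apply]
    rw [hx]
    ring

theorem norm_mul_sub_mul_le {x y x' y' : ℂ} {X Y : ℝ} (hx : ‖x‖ ≤ X) (hy : ‖y'‖ ≤ Y) :
    ‖x' * y' - x * y‖ ≤ ‖x' - x‖ * Y + X * ‖y' - y‖ := by
  rw [show x' * y' - x * y = (x' - x) * y' + x * (y' - y) by ring]
  refine (norm_add_le _ _).trans ?_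
  rw [norm_mul, norm_mul]
  gcongr

/-- The coefficients of the planar system depend in a Lipschitz way on `a`, `μ.dens` and
`μ.reg`. -/
theorem coeffDist_le {a b : ℝ → ℂ} {μ : LocalMeasure} {B : ℝ} (hbB : ∀ x, ‖b x‖ ≤ B)
    (hba : ∀ᵐ x, b x * a x = 1) (hμ : μ.unifNorm < ⊤) (z : ℂ) :
    ∃ M, 0 ≤ M ∧ ∀ p, ∀ᵐ x, coeffDist (fun x => b x * μ.reg x) b
      (fun x => μ.dens x - z - b x * μ.reg x * μ.reg x) p x ≤
        M * (‖a x - a (x + p)‖ +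
          (‖(μ - μ.translate p).dens x‖ + ‖(μ - μ.translate p).reg x‖)) := by
  have hNK := μ.norm_reg_le hμ
  set K := μ.unifNorm.toReal with hK
  have hK0 : 0 ≤ K := ENNReal.toReal_nonneg
  have hB0 : 0 ≤ B := (norm_nonneg _).trans (hbB 0)
  refine ⟨(K + 1 + K * K) * (B * B) + (B + (B * K + B * K)) + 1, by positivity, fun p => ?_⟩
  filter_upwards [hba, (quasiMeasurePreserving_add_right volume p).ae hba] with x h1 h2
  rw [μ.dens_sub_translate, μ.reg_sub_translate, norm_sub_rev (μ.dens x),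
    norm_sub_rev (μ.reg x)]
  -- Differences of reciprocals: `1/a' - 1/a = (a - a') / (a a')`.
  have hb : ‖b (x + p) - b x‖ ≤ B * B * ‖a x - a (x + p)‖ := by
    rw [show b (x + p) - b x = b x * b (x + p) * (a x - a (x + p)) by
      linear_combination b x * h2 - b (x + p) * h1, norm_mul, norm_mul]
    gcongr
    exacts [hbB _, hbB _]
  have hbN' : ‖b x * μ.reg x‖ ≤ B * K := by
    rw [norm_mul]
    exact mul_le_mul (hbB x) (hNK x) (norm_nonneg _) hB0
  have hα := norm_mul_sub_mul_le (x' := b (x + p)) (y := μ.reg x) (hbB x) (hNK (x + p))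
  have hα2 := norm_mul_sub_mul_le (x' := b (x + p) * μ.reg (x + p)) (y := μ.reg x) hbN'
    (hNK (x + p))
  have hγ : ‖(μ.dens (x + p) - z - b (x + p) * μ.reg (x + p) * μ.reg (x + p)) -
      (μ.dens x - z - b x * μ.reg x * μ.reg x)‖ ≤ ‖μ.dens (x + p) - μ.dens x‖ +
        ‖b (x + p) * μ.reg (x + p) * μ.reg (x + p) - b x * μ.reg x * μ.reg x‖ := by
    rw [show ∀ r s t w : ℂ, (r - z - s) - (t - z - w) = (r - t) - (s - w) by intros; ring]
    exact norm_sub_le _ _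
  unfold coeffDist
  dsimp only
  set δb := ‖b (x + p) - b x‖
  set δN := ‖μ.reg (x + p) - μ.reg x‖
  set δρ := ‖μ.dens (x + p) - μ.dens x‖
  set δα := ‖b (x + p) * μ.reg (x + p) - b x * μ.reg x‖
  set δa := ‖a x - a (x + p)‖
  have hN0 : 0 ≤ δN := norm_nonneg _
  have hρ0 : 0 ≤ δρ := norm_nonneg _
  have ha0 : 0 ≤ δa := norm_nonneg _
  calc _ ≤ δα + δb + (δρ + (δα * K + B * K * δN)) := by linarith
    _ ≤ (δb * K + B * δN) + δb + (δρ + ((δb * K + B * δN) * K + B * K * δN)) := by gcongr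
    _ = (K + 1 + K * K) * δb + (B + (B * K + B * K)) * δN + 1 * δρ := by ring
    _ ≤ (K + 1 + K * K) * (B * B * δa) + (B + (B * K + B * K)) * δN + 1 * δρ := by gcongr
    _ = (K + 1 + K * K) * (B * B) * δa + (B + (B * K + B * K)) * δN + 1 * δρ := by ring
    _ ≤ _ := by
      rw [mul_add, mul_add]
      have i1 : 0 ≤ (K + 1 + K * K) * (B * B) := by positivity
      have i2 : 0 ≤ B + (B * K + B * K) := by positivity
      nlinarith [mul_nonneg i1 hN0, mul_nonneg i1 hρ0, mul_nonneg i2 ha0, mul_nonneg i2 hρ0]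

/-- Integrated over `(-p, p - 2)`, the distance of the coefficients of the planar system to their
translates by `p` is controlled by the distances of `a` and `μ` to their translates. -/
theorem integral_coeffDist_le {a : ℝ → ℂ} {μ : LocalMeasure} (ha : MemLp a ⊤ volume)
    {α β γ u v : ℝ → ℂ} {L M p : ℝ} (h : IsSystemSolution α β γ L u v) (hM : 0 ≤ M) (hp : 2 ≤ p)
    (hle : ∀ᵐ x, coeffDist α β γ p x ≤ M * (‖a x - a (x + p)‖ +
      (‖(μ - μ.translate p).dens x‖ + ‖(μ - μ.translate p).reg x‖)))
    (hfin : (μ - μ.translate p).weakNorm (Icc (-p) p) ≠ ⊤) :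
    ∫ x in -p..p - 2, coeffDist α β γ p x ≤ 8 * M * p *
      (eLpNorm (fun x => a x - a (x + p)) 1 (volume.restrict (Ioo (-p) p)) +
        (μ - μ.translate p).weakNorm (Icc (-p) p)).toReal := by
  have hal : LocallyIntegrable a := ha.locallyIntegrable le_top
  have hai : LocallyIntegrable fun x => a x - a (x + p) := hal.sub (hal.comp_add_right p)
  have hIoo : IntegrableOn (fun x => a x - a (x + p)) (Ioo (-p) p) :=
    (hai.integrableOn_isCompact isCompact_Icc).mono_set Ioo_subset_Icc_self
  have hd : LocallyIntegrable (μ - μ.translate p).dens := LocalMeasure.locallyIntegrable_dens _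
  have hr : LocallyIntegrable (μ - μ.translate p).reg := LocalMeasure.locallyIntegrable_reg _
  have i1 := (hai.intervalIntegrable' (-p) (p - 2)).norm
  have i2 := (hd.intervalIntegrable' (-p) (p - 2)).norm.add
    (hr.intervalIntegrable' (-p) (p - 2)).norm
  have hci : IntervalIntegrable (coeffDist α β γ p) volume (-p) (p - 2) :=
    ((h.locallyIntegrable_coeffDist p).integrableOn_isCompact isCompact_uIcc).intervalIntegrable
  have hdr := LocalMeasure.integral_norm_dens_reg_long_le _ hp hfin
  have hE : ∫ x in -p..p - 2, ‖a x - a (x + p)‖ ≤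
      (eLpNorm (fun x => a x - a (x + p)) 1 (volume.restrict (Ioo (-p) p))).toReal := by
    rw [eLpNorm_one_eq_lintegral_enorm, ← integral_norm_eq_lintegral_enorm
      hIoo.aestronglyMeasurable, intervalIntegral.integral_of_le (by linarith)]
    exact setIntegral_mono_set hIoo.norm (Eventually.of_forall fun x => norm_nonneg _)
      (Eventually.of_forall fun x hx => ⟨hx.1, hx.2.trans_lt (by linarith)⟩)
  have hEfin : eLpNorm (fun x => a x - a (x + p)) 1 (volume.restrict (Ioo (-p) p)) ≠ ⊤ :=
    (memLp_one_iff_integrable.2 hIoo).eLpNorm_lt_top.ne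
  have hE0 := ENNReal.toReal_nonneg
    (a := eLpNorm (fun x => a x - a (x + p)) 1 (volume.restrict (Ioo (-p) p)))
  rw [ENNReal.toReal_add hEfin hfin]
  set e := (eLpNorm (fun x => a x - a (x + p)) 1 (volume.restrict (Ioo (-p) p))).toReal
  set w := ((μ - μ.translate p).weakNorm (Icc (-p) p)).toReal
  calc _ ≤ ∫ x in -p..p - 2, M * (‖a x - a (x + p)‖ +
      (‖(μ - μ.translate p).dens x‖ + ‖(μ - μ.translate p).reg x‖)) :=
        intervalIntegral.integral_mono_ae (by linarith)
          hci
          ((i1.add i2).const_mul M) hle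
    _ = M * ((∫ x in -p..p - 2, ‖a x - a (x + p)‖) + ∫ x in -p..p - 2,
          (‖(μ - μ.translate p).dens x‖ + ‖(μ - μ.translate p).reg x‖)) := by
        rw [intervalIntegral.integral_const_mul, intervalIntegral.integral_add i1 i2]
    _ ≤ M * (8 * p * e + 8 * p * w) := by
        refine mul_le_mul_of_nonneg_left (add_le_add (hE.trans ?_) hdr) hM
        exact le_mul_of_one_le_left hE0 (by linarith)
    _ = _ := by ring

/-! ### Absence of eigenvalues -/

theorem mainTheorem5 (a : ℝ → ℂ) (ha : MemLp a (⊤ : ℝ≥0∞) volume) (ha_ne : ∀ᵐ x : ℝ, a x ≠ 0)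
    (ha_inv : MemLp (fun x => 1 / a x) (⊤ : ℝ≥0∞) volume)
    (μ : LocalMeasure) (hμ : μ.unifNorm < (⊤ : ℝ≥0∞))
    (hexp : ∀ C : ℝ, 0 < C → ∃ p : ℕ → ℝ, (∀ m, 0 < p m) ∧ Tendsto p atTop atTop ∧
      ExpApprox a μ C p) :
    ∀ z : ℂ, ¬ IsEigenvalue (sturmLiouville a μ) z := by
  rintro z ⟨u, hu0, hu⟩
  obtain ⟨b, B, hb, hbB, hb_ae⟩ := ha_inv.exists_bounded_ae_eq
  have hba : ∀ᵐ x, b x * a x = 1 := by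
    filter_upwards [hb_ae, ha_ne] with x h1 h2
    rw [h1, one_div_mul_cancel h2]
  obtain ⟨L, v, hsol⟩ := exists_isSystemSolution ha hb hbB hba hμ hu
  obtain ⟨M, hM0, hM⟩ := coeffDist_le hbB hba hμ z
  -- Gordon's argument takes the rate `6 L + 1`; one more unit absorbs the factor `p ≤ exp p`, which
  -- comes from summing over about `2 p` windows.
  obtain ⟨p, -, hp, hE⟩ := hexp (6 * L + 2) (by linarith [hsol.L_nonneg])
  unfold ExpApprox at hE
  refine hu0 (DFunLike.coe_injective (hsol.eq_zero_of_approx_periodic ?_ (zero_at_infty u) hp ?_))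
  · filter_upwards [hba] with x hx h0
    rw [h0, zero_mul] at hx
    exact zero_ne_one hx
  have hE' := ((ENNReal.tendsto_toReal ENNReal.zero_ne_top).comp hE).const_mul (8 * M)
  rw [ENNReal.toReal_zero, mul_zero] at hE'
  refine squeeze_zero' ?_ ?_ hE'
  · filter_upwards [hp.eventually_ge_atTop 2] with m hm
    refine mul_nonneg (Real.exp_pos _).le
      (intervalIntegral.integral_nonneg (by linarith) fun x _ =>
        IsSystemSolution.coeffDist_nonneg _ _)
  · filter_upwards [hp.eventually_ge_atTop 2, hE.eventually_lt_const ENNReal.zero_lt_top]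
      with m hm hfin
    -- Real-valued bounds need finiteness, as `toReal` sends `⊤` to `0`. It holds eventually,
    -- because the product tends to zero and its exponential factor is positive.
    have hne : (μ - μ.translate (p m)).weakNorm (Icc (-p m) (p m)) ≠ ⊤ := by
      intro htop
      rw [htop, add_top, ENNReal.mul_top (ENNReal.ofReal_pos.2 (Real.exp_pos _)).ne'] at hfin
      exact lt_irrefl _ hfin
    have h1 := integral_coeffDist_le ha hsol hM0 hm (hM (p m)) hne
    simp only [Function.comp_apply]
    rw [ENNReal.toReal_mul, ENNReal.toReal_ofReal (Real.exp_pos _).le]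
    set E := (eLpNorm (fun x => a x - a (x + p m)) 1 (volume.restrict (Ioo (-p m) (p m))) +
        (μ - μ.translate (p m)).weakNorm (Icc (-p m) (p m))).toReal
    have hE0 : 0 ≤ E := ENNReal.toReal_nonneg
    have hpe : p m ≤ Real.exp (p m) := by linarith [Real.add_one_le_exp (p m)]
    calc _ ≤ Real.exp ((6 * L + 1) * p m) * (8 * M * Real.exp (p m) * E) := by
          refine mul_le_mul_of_nonneg_left (h1.trans ?_) (Real.exp_pos _).le
          gcongr
      _ = 8 * M * (Real.exp ((6 * L + 1) * p m) * Real.exp (p m) * E) := by ring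
      _ = _ := by
          rw [← Real.exp_add]
          ring_nf
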